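/- Let $n\ge 2$ and $0<\alpha<1$, and put $2^*_\alpha=\frac{2n}{n-2\alpha}$, $q=\frac{n+2\alpha}{n-2\alpha}$. Let $V:\mathbb R^n\to\mathbb R$ be continuous with $V\ge V_0$ for a constant $V_0>0$ and $V(x)\to\infty$ as $|x|\to\infty$. Let $H^\alpha_V$ be the space of real $u\in L^2(\mathbb R^n)$ with $\iint\frac{|u(x)-u(z)|^2}{|x-z|^{n+2\alpha}}\,dx\,dz<\infty$ and $\int Vu^2\,dx<\infty$, with inner product $$\langle u,w\rangle_V=\iint\frac{(u(x)-u(z))(w(x)-w(z))}{|x-z|^{n+2\alpha}}\,dx\,dz+\int Vuw\,dx$$ and norm $\|u\|_V=\langle u,u\rangle_V^{1/2}$. Let $C_e$ be the Sobolev constant, i.e. the least constant with $\|u\|_{L^2}\le C_e\|u\|_V$ and $\|u\|_{L^{2^*_\alpha}}\le C_e\|u\|_V$ for all $u\in H^\alpha_V$. Let $f:\mathbb R\to\mathbb R$ be continuous with $f(0)=0$, $f(t)=o(|t|)$ as $t\to0$, $f(t)=o(|t|^{q})$ as $|t|\to\infty$, and suppose that for some $\mu>2$, with $F(t)=\int_0^tf(s)\,ds$,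 one has $0<\mu F(t)\le tf(t)$ for all $t\ne0$. Let $0<\varepsilon<\frac1{2C_e^2}$, let $0<\delta\le\rho$ be such that $|f(t)|\le\varepsilon|t|$ for $|t|\le\delta$ and $|f(t)|\le\varepsilon|t|^{q}$ for $|t|\ge\rho$, put $K_\varepsilon=\delta^{-q}\max_{\delta\le|t|\le\rho}|f(t)|$, and let $\varrho>0$. Let $h\in L^2(\mathbb R^n)$, $h\not\equiv0$, with $$\|h\|_{L^2}<\frac{\varrho}{C_e}\Bigl(\tfrac12-\varepsilon C_e^2-(\varepsilon+K_\varepsilon)C_e^{2^*_\alpha}\varrho^{2^*_\alpha-2}\Bigr).$$ Then the equation $(-\Delta)^\alpha u+Vu=f(u)+h$ on $\mathbb R^n$ has at least two distinct weak solutions $u_1,u_2\in H^\alpha_V$, where $u\in H^\alpha_V$ is a weak solution if $\langle u,w\rangle_V=\int(f(u)+h)w\,dx$ for all $w\in H^\alpha_V$. Moreover, $u_1$ and $u_2$ can be chosen to be critical points of $I(u)=\frac12\|u\|_V^2-\int F(u)\,dx-\int hu\,dx$ on $H^\alpha_V$ such that $$I(u_1)=\inf_{\gamma\in\Gamma}\max_{t\in[0,1]}I(\gamma(t))>0,$$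 with $\Gamma=\{\gamma\in C([0,1],H^\alpha_V):\gamma(0)=0,\ \|\gamma(1)\|_V>\varrho,\ I(\gamma(1))\le0\}$ (which is non-empty), and $\|u_2\|_V<\varrho$, $I(u_2)=\min_{\|w\|_V\le\varrho}I(w)\le0$. -/

import Mathlib

open MeasureTheory Filter Topology Asymptotics

namespace FracSchrodinger

/-- Euclidean space `ℝⁿ`. -/
abbrev E (n : ℕ) : Type := EuclideanSpace ℝ (Fin n)

/-- The critical exponent `2*_α = 2n / (n - 2α)`. -/
noncomputable def critExp (n : ℕ) (α : ℝ) : ℝ := 2 * n / (n - 2 * α)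

/-- The growth exponent `(n + 2α) / (n - 2α) = 2*_α - 1`. -/
noncomputable def growthExp (n : ℕ) (α : ℝ) : ℝ := (n + 2 * α) / (n - 2 * α)

/-- `u ∈ H^α(ℝⁿ)`: `u ∈ L²` and the Gagliardo double integral is finite. -/
def MemH {n : ℕ} (α : ℝ) (u : E n → ℝ) : Prop :=
  MemLp u 2 volume ∧
    Integrable (fun p : E n × E n => (u p.1 - u p.2) ^ 2 / ‖p.1 - p.2‖ ^ ((n : ℝ) + 2 * α))
      (volume.prod volume)

/-- `u ∈ H^α_V(ℝⁿ)`: `u ∈ H^α(ℝⁿ)` and `∫ V u² < ∞`. Functions are not identified when they agree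
almost everywhere; the results below speak of a.e. equality explicitly. -/
def MemHV {n : ℕ} (α : ℝ) (V : E n → ℝ) (u : E n → ℝ) : Prop :=
  MemH α u ∧ Integrable (fun x => V x * u x ^ 2) volume

/-- The inner product `⟨u, w⟩_V` of `H^α_V(ℝⁿ)`. -/
noncomputable def innerV {n : ℕ} (α : ℝ) (V : E n → ℝ) (u w : E n → ℝ) : ℝ :=
  (∫ p : E n × E n, (u p.1 - u p.2) * (w p.1 - w p.2) / ‖p.1 - p.2‖ ^ ((n : ℝ) + 2 * α)
    ∂(volume.prod volume)) + ∫ x, V x * u x * w x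

/-- The norm `‖u‖_V` of `H^α_V(ℝⁿ)`. -/
noncomputable def normV {n : ℕ} (α : ℝ) (V : E n → ℝ) (u : E n → ℝ) : ℝ :=
  Real.sqrt (innerV α V u u)

/-- The Sobolev constant `C_e`: the least `C ≥ 0` such that `‖u‖_{L²} ≤ C ‖u‖_V` and
`‖u‖_{L^{2*_α}} ≤ C ‖u‖_V` for all `u ∈ H^α_V(ℝⁿ)`. -/
noncomputable def sobolevConst {n : ℕ} (α : ℝ) (V : E n → ℝ) : ℝ :=
  sInf {C : ℝ | 0 ≤ C ∧ ∀ u : E n → ℝ, MemHV α V u →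
    eLpNorm u 2 volume ≤ ENNReal.ofReal (C * normV α V u) ∧
    eLpNorm u (ENNReal.ofReal (critExp n α)) volume ≤ ENNReal.ofReal (C * normV α V u)}

/-- The primitive `F(t) = ∫₀ᵗ f(s) ds`. -/
noncomputable def primitive (f : ℝ → ℝ) (t : ℝ) : ℝ := ∫ s in (0 : ℝ)..t, f s

/-- `K_ε = δ^{-q} max_{δ ≤ |t| ≤ ρ} |f(t)|`; used with `q = (n + 2α) / (n - 2α)` and `0 < δ ≤ ρ`. -/
noncomputable def growthConst (f : ℝ → ℝ) (q δ ρ : ℝ) : ℝ :=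
  δ ^ (-q) * sSup ((fun t => |f t|) '' {t : ℝ | δ ≤ |t| ∧ |t| ≤ ρ})

/-- The energy functional `I(u) = ½‖u‖_V² - ∫ F(u) - ∫ h u`. -/
noncomputable def energy {n : ℕ} (α : ℝ) (V : E n → ℝ) (f : ℝ → ℝ) (h : E n → ℝ)
    (u : E n → ℝ) : ℝ :=
  normV α V u ^ 2 / 2 - (∫ x, primitive f (u x)) - ∫ x, h x * u x

/-- Weak solutions in `H^α_V(ℝⁿ)` of `(-Δ)^α u + V u = f(u) + h`. -/
def IsWeakSolution {n : ℕ} (α : ℝ) (V : E n → ℝ) (f : ℝ → ℝ) (h : E n → ℝ)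
    (u : E n → ℝ) : Prop :=
  MemHV α V u ∧ ∀ w : E n → ℝ, MemHV α V w →
    Integrable (fun x => (f (u x) + h x) * w x) volume ∧
    innerV α V u w = ∫ x, (f (u x) + h x) * w x

/-- `u` is a critical point of the energy on `H^α_V(ℝⁿ)`: the Fréchet derivative at `u` exists
and vanishes, i.e. `I(u + w) - I(u) = o(‖w‖_V)`. -/
def IsCriticalPt {n : ℕ} (α : ℝ) (V : E n → ℝ) (f : ℝ → ℝ) (h : E n → ℝ)
    (u : E n → ℝ) : Prop :=
  MemHV α V u ∧ ∀ c > 0, ∃ r > 0, ∀ w : E n → ℝ, MemHV α V w → normV α V w < r →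
    |energy α V f h (u + w) - energy α V f h u| ≤ c * normV α V w

/-- The admissible paths of the mountain pass: continuous `γ : [0,1] → H^α_V(ℝⁿ)` with
`γ(0) = 0`, `‖γ(1)‖_V > r` and `I(γ(1)) ≤ 0`. -/
def IsMountainPath {n : ℕ} (α : ℝ) (V : E n → ℝ) (f : ℝ → ℝ) (h : E n → ℝ) (r : ℝ)
    (γ : ℝ → E n → ℝ) : Prop :=
  (∀ t ∈ Set.Icc (0 : ℝ) 1, MemHV α V (γ t)) ∧
  (∀ t ∈ Set.Icc (0 : ℝ) 1,
    Tendsto (fun s => normV α V (γ s - γ t)) (𝓝[Set.Icc (0 : ℝ) 1] t) (𝓝 0)) ∧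
  γ 0 =ᵐ[volume] 0 ∧ r < normV α V (γ 1) ∧ energy α V f h (γ 1) ≤ 0

/-- `c = inf_γ max_{t ∈ [0,1]} I(γ(t))` over the admissible paths. Being a greatest lower bound in
`ℝ`, this includes that admissible paths exist. -/
def IsMountainPassLevel {n : ℕ} (α : ℝ) (V : E n → ℝ) (f : ℝ → ℝ) (h : E n → ℝ) (r c : ℝ) :
    Prop :=
  IsGLB {m : ℝ | ∃ γ : ℝ → E n → ℝ, IsMountainPath α V f h r γ ∧
    IsGreatest ((fun t => energy α V f h (γ t)) '' Set.Icc (0 : ℝ) 1) m} c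

end FracSchrodinger

/-!
The map `u ↦ ((u(x) - u(y)) / ‖x - y‖ ^ (n / 2 + α), √V u)` identifies `H^α_V` with a closed
subspace of a product of two `L²` spaces. This Hilbert space embeds continuously into `L^{2*_α}` by
the fractional Sobolev inequality, and compactly into `L²`: averaging over small sets approximates
`u` on bounded sets, and `V → ∞` controls its mass near infinity. On it the energy is `C¹`, and it
satisfies the Palais–Smale condition, since the Ambrosetti–Rabinowitz condition bounds Palais–Smale
sequences and the compactness of the embedding makes them converge. The smallness of `h` keeps the
energy above a positive constant on the sphere of radius `r`. Minimising over the ball inside this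
sphere gives `u₂`, with energy at most `I(0) = 0`, and the mountain pass theorem gives `u₁`, with
positive energy, so the two differ. Both critical points are extracted by Ekeland's variational
principle, on the ball and on the space of admissible paths respectively.
-/

open scoped Gradient ENNReal

namespace FracSchrodinger

section Ekeland

variable {X : Type*} [MetricSpace X] {Φ : X → ℝ} {η : ℝ} {x y : X}

/-- The points below `x` in Ekeland's order: `y ≤ x` if moving from `x` to `y` lowers `Φ` at a rate
of at least `η`. -/
def ekelandSet (Φ : X → ℝ) (η : ℝ) (x : X) : Set X :=
  {y | Φ y + η * dist x y ≤ Φ x}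

theorem self_mem_ekelandSet : x ∈ ekelandSet Φ η x := by
  simp [ekelandSet]

theorem ekelandSet_subset (hη : 0 ≤ η) (hy : y ∈ ekelandSet Φ η x) :
    ekelandSet Φ η y ⊆ ekelandSet Φ η x := by
  intro z hz
  simp only [ekelandSet, Set.mem_ofPred_eq] at *
  nlinarith [dist_triangle x y z]

theorem isClosed_ekelandSet (hΦ : LowerSemicontinuous Φ) : IsClosed (ekelandSet Φ η x) :=
  have : LowerSemicontinuous fun y => η * dist x y := Continuous.lowerSemicontinuous (by fun_prop)
  (hΦ.add this).isClosed_preimage (Φ x)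

theorem exists_dist_le_of_mem_ekelandSet (hb : BddBelow (Set.range Φ)) (hη : 0 < η) (x : X)
    {δ : ℝ} (hδ : 0 < δ) :
    ∃ y ∈ ekelandSet Φ η x, ∀ z ∈ ekelandSet Φ η y, dist z y ≤ δ := by
  obtain ⟨_, ⟨y, hy, rfl⟩, hlt⟩ := exists_lt_of_csInf_lt (s := Φ '' ekelandSet Φ η x)
    ⟨_, x, self_mem_ekelandSet, rfl⟩ (lt_add_of_pos_right _ (mul_pos hη hδ))
  refine ⟨y, hy, fun z hz => ?_⟩
  have hle : sInf (Φ '' ekelandSet Φ η x) ≤ Φ z :=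
    csInf_le (hb.mono (Set.image_subset_range _ _)) ⟨z, ekelandSet_subset hη.le hy hz, rfl⟩
  have hdist : Φ z + η * dist y z ≤ Φ y := hz
  rw [dist_comm]
  exact le_of_mul_le_mul_left (by linarith) hη

theorem exists_ekelandSet_subset_singleton [CompleteSpace X] (hΦ : LowerSemicontinuous Φ)
    (hb : BddBelow (Set.range Φ)) (hη : 0 < η) (x₀ : X) :
    ∃ a ∈ ekelandSet Φ η x₀, ekelandSet Φ η a ⊆ {a} := by
  have hstep : ∀ (k : ℕ) (x : X), ∃ y ∈ ekelandSet Φ η x, ∀ z ∈ ekelandSet Φ η y,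
      dist z y ≤ (1 / 2 : ℝ) ^ k := fun k x =>
    exists_dist_le_of_mem_ekelandSet hb hη x (by positivity)
  choose next hnext hdist using hstep
  let x : ℕ → X := fun k => Nat.rec (next 0 x₀) (fun k y => next (k + 1) y) k
  have hanti : Antitone fun k => ekelandSet Φ η (x k) :=
    antitone_nat_of_succ_le fun k => ekelandSet_subset hη.le (hnext _ _)
  have hball : ∀ k, ekelandSet Φ η (x k) ⊆ Metric.closedBall (x k) ((1 / 2 : ℝ) ^ k) := by
    rintro (_ | k) z hz
    exacts [hdist _ _ z hz, hdist _ _ z hz]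
  have hdiam : Tendsto (fun k => Metric.diam (ekelandSet Φ η (x k))) atTop (𝓝 0) := by
    refine squeeze_zero (fun _ => Metric.diam_nonneg) (fun k =>
      (Metric.diam_mono (hball k) Metric.isBounded_closedBall).trans
        (Metric.diam_closedBall (by positivity))) ?_
    simpa using (tendsto_pow_atTop_nhds_zero_of_lt_one (r := (1 / 2 : ℝ)) (by norm_num)
      (by norm_num)).const_mul 2
  obtain ⟨a, ha⟩ := Metric.nonempty_iInter_of_nonempty_biInter
    (fun k => isClosed_ekelandSet (x := x k) (η := η) hΦ)
    (fun k => Metric.isBounded_closedBall.subset (hball k))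
    (fun N => ⟨x N, Set.mem_iInter₂.2 fun k hk => hanti hk self_mem_ekelandSet⟩) hdiam
  rw [Set.mem_iInter] at ha
  refine ⟨a, ekelandSet_subset hη.le (hnext 0 x₀) (ha 0), fun y hy => ?_⟩
  refine dist_le_zero.1 (ge_of_tendsto' hdiam fun k => ?_)
  exact Metric.dist_le_diam_of_mem (Metric.isBounded_closedBall.subset (hball k))
    (ekelandSet_subset hη.le (ha k) hy) (ha k)

theorem ekeland [CompleteSpace X] (hΦ : LowerSemicontinuous Φ) (hb : BddBelow (Set.range Φ))
    (hη : 0 < η) (x₀ : X) : ∃ x, Φ x ≤ Φ x₀ ∧ ∀ y, Φ x ≤ Φ y + η * dist x y := by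
  obtain ⟨a, ha, hmin⟩ := exists_ekelandSet_subset_singleton hΦ hb hη x₀
  refine ⟨a, (le_add_of_nonneg_right (by positivity)).trans ha, fun y => ?_⟩
  by_contra! hlt
  obtain rfl := hmin hlt.le
  simp at hlt

end Ekeland

section Gradient

variable {H : Type*} [NormedAddCommGroup H] [InnerProductSpace ℝ H] [CompleteSpace H]
  {I : H → ℝ} {u v : H} {η c : ℝ}

theorem continuous_gradient (hI : ContDiff ℝ 1 I) : Continuous (∇ I) :=
  (InnerProductSpace.toDual ℝ H).symm.continuous.comp (hI.continuous_fderiv one_ne_zero)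

theorem contDiff_one_of_hasGradientAt {g : H → H} (hI : ∀ u, HasGradientAt I (g u) u)
    (hg : Continuous g) : ContDiff ℝ 1 I :=
  contDiff_one_iff_hasFDerivAt.2
    ⟨_, (InnerProductSpace.toDual ℝ H).continuous.comp hg, fun u => (hI u).hasFDerivAt⟩

theorem hasDerivAt_line (hI : Differentiable ℝ I) (u v : H) (t : ℝ) :
    HasDerivAt (fun t : ℝ => I (u + t • v)) (inner ℝ (∇ I (u + t • v)) v) t := by
  have hline : HasDerivAt (fun t : ℝ => u + t • v) v t := by
    simpa using ((hasDerivAt_id t).smul_const v).const_add u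
  rw [inner_gradient_left]
  exact (hI (u + t • v)).hasFDerivAt.comp_hasDerivAt t hline

theorem exists_inner_gradient_eq (hI : Differentiable ℝ I) (u v : H) {s : ℝ} (hs : 0 < s) :
    ∃ θ ∈ Set.Ioo 0 s, I (u + s • v) - I u = s * inner ℝ (∇ I (u + θ • v)) v := by
  have hd := hasDerivAt_line hI u v
  obtain ⟨θ, hθ, h⟩ := exists_hasDerivAt_eq_slope (fun t : ℝ => I (u + t • v)) _ hs
    (fun t _ => (hd t).continuousAt.continuousWithinAt) (fun t _ => hd t)
  refine ⟨θ, hθ, ?_⟩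
  rw [h, sub_zero, zero_smul, add_zero, mul_div_cancel₀ _ hs.ne']

theorem norm_gradient_le_of_eventually_le (hI : Differentiable ℝ I) (hη : 0 ≤ η)
    (h : ∀ᶠ y in 𝓝 u, I u ≤ I y + η * dist u y) : ‖∇ I u‖ ≤ η := by
  have hderiv := hasDerivAt_line hI u (-∇ I u) 0
  rw [zero_smul, add_zero, inner_neg_right, real_inner_self_eq_norm_sq] at hderiv
  have hlim : Tendsto (fun s : ℝ => u + s • -∇ I u) (𝓝[>] 0) (𝓝 u) := by
    have : Continuous fun s : ℝ => u + s • -∇ I u := by fun_prop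
    simpa using (this.tendsto 0).mono_left nhdsWithin_le_nhds
  have hslope : -(η * ‖∇ I u‖) ≤ -‖∇ I u‖ ^ 2 := by
    refine ge_of_tendsto hderiv.tendsto_slope_zero_right ?_
    filter_upwards [hlim.eventually h, self_mem_nhdsWithin] with s hs hs0
    rw [dist_self_add_right, norm_smul, norm_neg, Real.norm_of_nonneg (le_of_lt hs0)] at hs
    simp only [zero_add, zero_smul, add_zero, smul_eq_mul]
    rw [← div_eq_inv_mul, le_div_iff₀ hs0]
    linarith
  by_contra! hlt
  nlinarith

end Gradient

section CriticalPoints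

variable {H : Type*} [NormedAddCommGroup H] [InnerProductSpace ℝ H] [CompleteSpace H]
  {I : H → ℝ} {u : H} {η c r : ℝ}

/-- The Palais–Smale condition: a sequence along which `I` is bounded and its gradient tends to `0`
has a convergent subsequence. -/
def PalaisSmale (I : H → ℝ) : Prop :=
  ∀ (u : ℕ → H) (B : ℝ), (∀ k, |I (u k)| ≤ B) → Tendsto (fun k => ∇ I (u k)) atTop (𝓝 0) →
    ∃ (a : H) (φ : ℕ → ℕ), StrictMono φ ∧ Tendsto (u ∘ φ) atTop (𝓝 a)

theorem PalaisSmale.exists_critical_mem (hPS : PalaisSmale I) (hI : ContDiff ℝ 1 I) {S : Set H}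
    (hS : IsClosed S) (h : ∀ η > 0, ∃ u ∈ S, |I u - c| ≤ η ∧ ‖∇ I u‖ ≤ η) :
    ∃ u ∈ S, I u = c ∧ ∇ I u = 0 := by
  choose u huS hval hgrad using fun k : ℕ => h (1 / ((k : ℝ) + 1)) (by positivity)
  have hlim := tendsto_one_div_add_atTop_nhds_zero_nat (𝕜 := ℝ)
  have hgrad' : Tendsto (fun k => ∇ I (u k)) atTop (𝓝 0) := squeeze_zero_norm hgrad hlim
  have hval' : Tendsto (fun k => I (u k)) atTop (𝓝 c) :=
    tendsto_iff_norm_sub_tendsto_zero.2 (squeeze_zero (fun _ => norm_nonneg _) hval hlim)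
  obtain ⟨B, hB⟩ := (Metric.isBounded_range_of_tendsto _ hval').exists_norm_le
  obtain ⟨a, φ, hφ, ha⟩ := hPS u B (fun k => hB _ ⟨k, rfl⟩) hgrad'
  exact ⟨a, hS.mem_of_tendsto ha (.of_forall fun k => huS (φ k)),
    tendsto_nhds_unique ((hI.continuous.tendsto a).comp ha) (hval'.comp hφ.tendsto_atTop),
    tendsto_nhds_unique (((continuous_gradient hI).tendsto a).comp ha)
      (hgrad'.comp hφ.tendsto_atTop)⟩

theorem exists_ball_almost_critical_minimizer (hI : ContDiff ℝ 1 I)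
    (hb : BddBelow (I '' Metric.closedBall 0 r)) (hu : u ∈ Metric.closedBall 0 r)
    (hsphere : ∀ w, ‖w‖ = r → I u < I w) (hη : 0 < η) :
    ∃ x ∈ Metric.closedBall (0 : H) r, I x ≤ I u ∧ ‖∇ I x‖ ≤ η := by
  have : CompleteSpace (Metric.closedBall (0 : H) r) :=
    Metric.isClosed_closedBall.completeSpace_coe
  obtain ⟨x, hxu, hx⟩ := ekeland (Φ := fun w : Metric.closedBall (0 : H) r => I w)
    (hI.continuous.comp continuous_subtype_val).lowerSemicontinuous
    (by rwa [Set.range_comp', Subtype.range_coe]) hη ⟨u, hu⟩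
  refine ⟨x, x.2, hxu, norm_gradient_le_of_eventually_le (hI.differentiable one_ne_zero) hη.le ?_⟩
  have hxr : ‖(x : H)‖ < r :=
    (mem_closedBall_zero_iff.1 x.2).lt_of_ne fun h => (hsphere _ h).not_ge hxu
  filter_upwards [Metric.isOpen_ball.mem_nhds (mem_ball_zero_iff.2 hxr)] with y hy
  exact hx ⟨y, Metric.ball_subset_closedBall hy⟩

theorem PalaisSmale.exists_ball_minimizer (hPS : PalaisSmale I) (hI : ContDiff ℝ 1 I)
    (hb : BddBelow (I '' Metric.closedBall 0 r)) (hu : u ∈ Metric.closedBall 0 r)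
    (hsphere : ∀ w, ‖w‖ = r → I u < I w) :
    ∃ a, ‖a‖ < r ∧ ∇ I a = 0 ∧ ∀ w, ‖w‖ ≤ r → I a ≤ I w := by
  set m := sInf (I '' Metric.closedBall 0 r)
  have hm : ∀ w, ‖w‖ ≤ r → m ≤ I w := fun w hw =>
    csInf_le hb ⟨w, mem_closedBall_zero_iff.2 hw, rfl⟩
  obtain ⟨a, har, ham, hgrad⟩ := hPS.exists_critical_mem (c := m) hI
    (Metric.isClosed_closedBall (x := (0 : H)) (ε := r)) fun η hη => by
      obtain ⟨_, ⟨y, hy, rfl⟩, hlt⟩ := exists_lt_of_csInf_lt (Set.Nonempty.image I ⟨u, hu⟩)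
        (lt_add_of_pos_right m hη)
      obtain ⟨z, hz, hzy, hzu⟩ : ∃ z ∈ Metric.closedBall 0 r, I z ≤ I y ∧ I z ≤ I u := by
        rcases le_total (I y) (I u) with h | h
        exacts [⟨y, hy, le_rfl, h⟩, ⟨u, hu, h, le_rfl⟩]
      obtain ⟨x, hx, hxz, hgx⟩ := exists_ball_almost_critical_minimizer hI hb hz
        (fun w hw => hzu.trans_lt (hsphere w hw)) hη
      have hmx := hm x (mem_closedBall_zero_iff.1 hx)
      exact ⟨x, hx, abs_le.2 ⟨by linarith, by linarith⟩, hgx⟩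
  rw [mem_closedBall_zero_iff] at har hu
  exact ⟨a, har.lt_of_ne fun h => (hsphere a h).not_ge (ham ▸ hm u hu), hgrad,
    fun w hw => ham ▸ hm w hw⟩

end CriticalPoints

section PathMax

variable {H : Type*} [TopologicalSpace H] {I : H → ℝ}

/-- The height `max_t I(γ(t))` of a path. -/
noncomputable def pathMax (I : H → ℝ) (γ : C(unitInterval, H)) : ℝ :=
  sSup ((fun t => I (γ t)) '' Set.univ)

theorem isGreatest_pathMax (hI : Continuous I) (γ : C(unitInterval, H)) :
    IsGreatest (Set.range fun t => I (γ t)) (pathMax I γ) := by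
  rw [pathMax, Set.image_univ]
  exact (isCompact_range (hI.comp γ.continuous)).isGreatest_sSup (Set.range_nonempty _)

theorem le_pathMax (hI : Continuous I) (γ : C(unitInterval, H)) (t : unitInterval) :
    I (γ t) ≤ pathMax I γ :=
  (isGreatest_pathMax hI γ).2 ⟨t, rfl⟩

theorem exists_eq_pathMax (hI : Continuous I) (γ : C(unitInterval, H)) :
    ∃ t, I (γ t) = pathMax I γ :=
  (isGreatest_pathMax hI γ).1

theorem continuous_pathMax (hI : Continuous I) : Continuous (pathMax I) :=
  isCompact_univ.continuous_sSup (f := fun (γ : C(unitInterval, H)) t => I (γ t))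
    (hI.comp continuous_eval)

end PathMax

section AdmissiblePaths

variable {H : Type*} [NormedAddCommGroup H] {I : H → ℝ} {r β : ℝ}

/-- The admissible paths of the mountain pass geometry: they start at `0` and end outside the ball
of radius `r` at a point where `I ≤ 0`. -/
def admissiblePaths (I : H → ℝ) (r : ℝ) : Set C(unitInterval, H) :=
  {γ | γ 0 = 0 ∧ r < ‖γ 1‖ ∧ I (γ 1) ≤ 0}

theorem admissiblePaths_nonempty [NormedSpace ℝ H] {e : H} (he : r < ‖e‖) (hIe : I e ≤ 0) :
    (admissiblePaths I r).Nonempty :=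
  ⟨⟨fun t => (t : ℝ) • e, by fun_prop⟩, by simp, by simpa using he, by simpa using hIe⟩

theorem le_pathMax_of_mem_admissiblePaths (hI : Continuous I) (hr : 0 ≤ r)
    (hsphere : ∀ u, ‖u‖ = r → β ≤ I u) (hγ : γ ∈ admissiblePaths I r) : β ≤ pathMax I γ := by
  obtain ⟨t, ht⟩ := intermediate_value_univ (0 : unitInterval) 1 γ.continuous.norm
    (show r ∈ Set.Icc ‖γ 0‖ ‖γ 1‖ from ⟨by rwa [hγ.1, norm_zero], hγ.2.1.le⟩)
  exact (hsphere _ ht).trans (le_pathMax hI γ t)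

end AdmissiblePaths

section MountainPass

variable {H : Type*} [NormedAddCommGroup H] [InnerProductSpace ℝ H] [CompleteSpace H] {I : H → ℝ}
  {γ v : C(unitInterval, H)} {η c r β : ℝ}

theorem exists_pathMax_sub_le_and_neg_le_inner (hI : Differentiable ℝ I) {s : ℝ} (hs : 0 < s)
    (h : pathMax I γ ≤ pathMax I (γ + s • v) + η * s) :
    ∃ (t : unitInterval) (θ : ℝ), θ ∈ Set.Ioo 0 s ∧
      -η ≤ inner ℝ (∇ I (γ t + θ • v t)) (v t) ∧ pathMax I γ - η * s ≤ I (γ t + s • v t) := by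
  obtain ⟨t, ht⟩ := exists_eq_pathMax hI.continuous (γ + s • v)
  replace ht : I (γ t + s • v t) = pathMax I (γ + s • v) := ht
  obtain ⟨θ, hθ, hmean⟩ := exists_inner_gradient_eq hI (γ t) (v t) hs
  refine ⟨t, θ, hθ, ?_, by linarith⟩
  refine le_of_mul_le_mul_left ?_ hs
  linarith [le_pathMax hI.continuous γ t]

/-- A one-sided form of Danskin's theorem on the derivative of a maximum. -/
theorem exists_eq_pathMax_and_neg_le_inner (hI : ContDiff ℝ 1 I)
    (h : ∀ s > 0, pathMax I γ ≤ pathMax I (γ + s • v) + η * s) :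
    ∃ t, I (γ t) = pathMax I γ ∧ -η ≤ inner ℝ (∇ I (γ t)) (v t) := by
  have hstep := fun k : ℕ => exists_pathMax_sub_le_and_neg_le_inner
    (hI.differentiable one_ne_zero) (s := 1 / ((k : ℝ) + 1)) (by positivity) (h _ (by positivity))
  choose t θ hθ hinner hval using hstep
  obtain ⟨τ, φ, hφ, hτ⟩ := CompactSpace.tendsto_subseq t
  have hs : Tendsto (fun k => 1 / ((φ k : ℝ) + 1)) atTop (𝓝 0) :=
    tendsto_one_div_add_atTop_nhds_zero_nat.comp hφ.tendsto_atTop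
  have hpoint : ∀ {σ : ℕ → ℝ}, Tendsto σ atTop (𝓝 0) →
      Tendsto (fun k => γ (t (φ k)) + σ k • v (t (φ k))) atTop (𝓝 (γ τ)) := fun hσ => by
    simpa using ((γ.continuous.tendsto τ).comp hτ).add
      (hσ.smul ((v.continuous.tendsto τ).comp hτ))
  have hθ0 : Tendsto (fun k => θ (φ k)) atTop (𝓝 0) :=
    squeeze_zero (fun k => (hθ _).1.le) (fun k => (hθ _).2.le) hs
  refine ⟨τ, le_antisymm (le_pathMax hI.continuous γ τ) ?_, ?_⟩
  · refine le_of_tendsto_of_tendsto' ?_ ((hI.continuous.tendsto _).comp (hpoint hs))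
      fun k => hval (φ k)
    simpa using (hs.const_mul η).const_sub (pathMax I γ)
  · exact ge_of_tendsto' ((((continuous_gradient hI).tendsto _).comp (hpoint hθ0)).inner
      ((v.continuous.tendsto τ).comp hτ)) fun k => hinner (φ k)

theorem exists_path_descent_direction (hI : ContDiff ℝ 1 I) (γ : C(unitInterval, H))
    (h0 : I (γ 0) < c) (h1 : I (γ 1) < c) (hη : 0 < η) :
    ∃ v : C(unitInterval, H), ‖v‖ ≤ 1 ∧ v 0 = 0 ∧ v 1 = 0 ∧
      ∀ t, c ≤ I (γ t) → η ≤ ‖∇ I (γ t)‖ → inner ℝ (∇ I (γ t)) (v t) = -‖∇ I (γ t)‖ := by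
  have hclosed : IsClosed {t | c ≤ I (γ t)} :=
    isClosed_le continuous_const (hI.continuous.comp γ.continuous)
  have hdisj : Disjoint ({0, 1} : Set unitInterval) {t | c ≤ I (γ t)} := by
    simpa [Set.disjoint_left] using ⟨h0, h1⟩
  obtain ⟨χ, hχ0, hχ1, hχ⟩ :=
    exists_continuous_zero_one_of_isClosed (Set.toFinite _).isClosed hclosed hdisj
  have hgrad : Continuous fun t => ∇ I (γ t) := (continuous_gradient hI).comp γ.continuous
  have hpos : ∀ t, 0 < max ‖∇ I (γ t)‖ η := fun t => lt_max_of_lt_right hη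
  let v : C(unitInterval, H) := ⟨fun t => -(χ t / max ‖∇ I (γ t)‖ η) • ∇ I (γ t),
    ((χ.continuous.div (hgrad.norm.max continuous_const) fun t => (hpos t).ne').neg).smul hgrad⟩
  have hv : ∀ t, v t = -(χ t / max ‖∇ I (γ t)‖ η) • ∇ I (γ t) := fun _ => rfl
  refine ⟨v, (ContinuousMap.norm_le _ zero_le_one).2 fun t => ?_, ?_, ?_, fun t htc htη => ?_⟩
  · rw [hv, norm_smul, norm_neg, Real.norm_of_nonneg (div_nonneg (hχ t).1 (hpos t).le),
      div_mul_eq_mul_div, div_le_one (hpos t)]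
    calc χ t * ‖∇ I (γ t)‖ ≤ 1 * ‖∇ I (γ t)‖ := by gcongr; exact (hχ t).2
      _ ≤ max ‖∇ I (γ t)‖ η := by rw [one_mul]; exact le_max_left _ _
  · simp [hv, hχ0 (Set.mem_insert _ _)]
  · simp [hv, hχ0 (Set.mem_insert_of_mem _ rfl)]
  · have hne : ‖∇ I (γ t)‖ ≠ 0 := (hη.trans_le htη).ne'
    rw [hv, hχ1 htc, Pi.one_apply, max_eq_left htη, inner_smul_right, real_inner_self_eq_norm_sq]
    field_simp

theorem exists_almost_critical_le_pathMax (hI : ContDiff ℝ 1 I) {γ₀ : C(unitInterval, H)}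
    (h0 : I (γ₀ 0) < c) (h1 : I (γ₀ 1) < c)
    (hc : ∀ γ : C(unitInterval, H), γ 0 = γ₀ 0 → γ 1 = γ₀ 1 → c ≤ pathMax I γ) (hη : 0 < η) :
    ∃ u, c ≤ I u ∧ I u ≤ pathMax I γ₀ ∧ ‖∇ I u‖ ≤ η := by
  let P : Set C(unitInterval, H) := {γ | γ 0 = γ₀ 0 ∧ γ 1 = γ₀ 1}
  have hP : IsClosed P := (isClosed_eq (by fun_prop) continuous_const).inter
    (isClosed_eq (by fun_prop) continuous_const)
  have : CompleteSpace P := hP.completeSpace_coe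
  obtain ⟨γ, hγ₀, hγ⟩ := ekeland (Φ := fun γ : P => pathMax I γ)
    ((continuous_pathMax hI.continuous).comp continuous_subtype_val).lowerSemicontinuous
    ⟨c, by rintro _ ⟨γ, rfl⟩; exact hc γ γ.2.1 γ.2.2⟩ hη ⟨γ₀, rfl, rfl⟩
  obtain ⟨v, hv, hv0, hv1, hdesc⟩ := exists_path_descent_direction hI γ.1
    (γ.2.1 ▸ h0) (γ.2.2 ▸ h1) hη
  obtain ⟨t, ht, hinner⟩ := exists_eq_pathMax_and_neg_le_inner (v := v) (η := η) hI fun s hs => by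
    refine (hγ ⟨γ + s • v, by simp [hv0, γ.2.1], by simp [hv1, γ.2.2]⟩).trans ?_
    gcongr
    rw [Subtype.dist_eq, dist_self_add_right, norm_smul, Real.norm_of_nonneg hs.le]
    exact mul_le_of_le_one_right hs.le hv
  have htc : c ≤ I (γ.1 t) := ht ▸ hc γ γ.2.1 γ.2.2
  refine ⟨γ.1 t, htc, ht.le.trans hγ₀, ?_⟩
  by_contra! hlt
  rw [hdesc t htc hlt.le] at hinner
  linarith

theorem PalaisSmale.mountain_pass (hPS : PalaisSmale I) (hI : ContDiff ℝ 1 I) (hzero : I 0 ≤ 0)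
    (hr : 0 ≤ r) (hβ : 0 < β) (hsphere : ∀ u, ‖u‖ = r → β ≤ I u) {e : H} (he : r < ‖e‖)
    (hIe : I e ≤ 0) :
    ∃ u, ∇ I u = 0 ∧ β ≤ I u ∧ IsGLB (pathMax I '' admissiblePaths I r) (I u) := by
  have hlow : β ∈ lowerBounds (pathMax I '' admissiblePaths I r) := by
    rintro _ ⟨γ, hγ, rfl⟩
    exact le_pathMax_of_mem_admissiblePaths hI.continuous hr hsphere hγ
  have hne := (admissiblePaths_nonempty he hIe).image (pathMax I)
  have hglb := isGLB_csInf hne ⟨β, hlow⟩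
  set c := sInf (pathMax I '' admissiblePaths I r)
  have hβc : β ≤ c := le_csInf hne hlow
  obtain ⟨u, -, huc, hu⟩ := hPS.exists_critical_mem hI (c := c) isClosed_univ fun η hη => by
    obtain ⟨_, ⟨γ, ⟨hγ0, hγ1, hIγ⟩, rfl⟩, hlt⟩ :=
      exists_lt_of_csInf_lt hne (lt_add_of_pos_right c hη)
    obtain ⟨u, hcu, huγ, hgrad⟩ := exists_almost_critical_le_pathMax (c := c) (γ₀ := γ) hI
      (by rw [hγ0]; linarith) (by linarith)
      (fun γ' h0 h1 => hglb.1 ⟨γ', ⟨h0.trans hγ0, h1 ▸ hγ1, h1 ▸ hIγ⟩, rfl⟩) hη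
    exact ⟨u, trivial, abs_le.2 ⟨by linarith, by linarith⟩, hgrad⟩
  exact ⟨u, hu, huc ▸ hβc, huc ▸ hglb⟩

end MountainPass

section Nonlinearity

variable {f : ℝ → ℝ} {q : ℝ}

/-- The class of nonlinearities of the paper: continuous, superlinear at the origin and of smaller
growth than the power `q` at infinity. The latter is required along `cocompact ℝ`, that is for
`|t| → ∞`. -/
structure IsSubcritical (f : ℝ → ℝ) (q : ℝ) : Prop where
  continuous : Continuous f
  isLittleO_zero : f =o[𝓝 0] fun t => |t|
  isLittleO_cocompact : f =o[cocompact ℝ] fun t => |t| ^ q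

/-- The Ambrosetti–Rabinowitz superquadraticity condition with exponent `μ`. -/
def AmbrosettiRabinowitz (f : ℝ → ℝ) (μ : ℝ) : Prop :=
  ∀ t : ℝ, t ≠ 0 → 0 < μ * primitive f t ∧ μ * primitive f t ≤ t * f t

theorem IsSubcritical.exists_abs_le_mul_abs (hf : IsSubcritical f q) {η : ℝ} (hη : 0 < η) :
    ∃ δ > 0, ∀ t, |t| < δ → |f t| ≤ η * |t| := by
  obtain ⟨δ, hδ, h⟩ := Metric.eventually_nhds_iff.1 (hf.isLittleO_zero.bound hη)
  exact ⟨δ, hδ, fun t ht => by simpa using h (by simpa using ht)⟩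

theorem IsSubcritical.apply_zero (hf : IsSubcritical f q) : f 0 = 0 := by
  obtain ⟨δ, hδ, h⟩ := hf.exists_abs_le_mul_abs one_pos
  simpa using h 0 (by simpa using hδ)

theorem IsSubcritical.exists_abs_le_add (hf : IsSubcritical f q) {η : ℝ} (hη : 0 < η) :
    ∃ M, ∀ t, |f t| ≤ M + η * |t| ^ q := by
  obtain ⟨R, hR⟩ : ∃ R, ∀ t, R < |t| → |f t| ≤ η * |t| ^ q := by
    have h := hf.isLittleO_cocompact.bound hη
    rw [← Metric.cobounded_eq_cocompact, ← comap_norm_atTop, eventually_comap] at h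
    obtain ⟨R, hR⟩ := eventually_atTop.1 h
    refine ⟨R, fun t ht => ?_⟩
    have := hR |t| ht.le t rfl
    rwa [Real.norm_eq_abs, Real.norm_of_nonneg (by positivity)] at this
  obtain ⟨M, hM⟩ := (isCompact_Icc (a := -R) (b := R)).exists_bound_of_continuousOn
    hf.continuous.continuousOn
  refine ⟨max M 0, fun t => ?_⟩
  have hpow : 0 ≤ η * |t| ^ q := by positivity
  rcases le_or_gt |t| R with h | h
  · have hMt : |f t| ≤ M := hM t (abs_le.1 h)
    linarith [le_max_left M 0]
  · linarith [hR t h, le_max_right M 0]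

theorem exists_abs_sub_le_of_abs_le (hf : Continuous f) (R : ℝ) {κ : ℝ} (hκ : 0 < κ) :
    ∃ C, 0 ≤ C ∧ ∀ s t, |s| ≤ R → |t| ≤ R → |f s - f t| ≤ κ + C * |s - t| := by
  have hcompact : IsCompact (Set.Icc (-R) R) := isCompact_Icc
  obtain ⟨M, hM⟩ := hcompact.exists_bound_of_continuousOn hf.continuousOn
  obtain ⟨τ, hτ, huc⟩ := Metric.uniformContinuousOn_iff.1
    (hcompact.uniformContinuousOn_of_continuous hf.continuousOn) κ hκ
  refine ⟨2 * |M| / τ, by positivity, fun s t hs ht => ?_⟩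
  rcases lt_or_ge |s - t| τ with h | h
  · have hclose : |f s - f t| < κ := huc s (abs_le.1 hs) t (abs_le.1 ht) h
    have : 0 ≤ 2 * |M| / τ * |s - t| := by positivity
    linarith
  · calc |f s - f t| ≤ |f s| + |f t| := abs_sub _ _
      _ ≤ |M| + |M| := add_le_add ((hM s (abs_le.1 hs)).trans (le_abs_self M))
          ((hM t (abs_le.1 ht)).trans (le_abs_self M))
      _ = 2 * |M| / τ * τ := by field_simp; ring
      _ ≤ 2 * |M| / τ * |s - t| := by gcongr
      _ ≤ κ + 2 * |M| / τ * |s - t| := le_add_of_nonneg_left hκ.le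

theorem IsSubcritical.exists_abs_sub_le (hf : IsSubcritical f q) (hq : 0 < q) {η : ℝ}
    (hη : 0 < η) : ∃ C : ℝ, 0 ≤ C ∧ ∀ s t : ℝ,
      |f s - f t| ≤ η * (|s| + |t| + |s| ^ q + |t| ^ q) + C * |s - t| := by
  obtain ⟨δ, hδ, hsmall⟩ := hf.exists_abs_le_mul_abs hη
  obtain ⟨M, hbound⟩ := hf.exists_abs_le_add (half_pos hη)
  obtain ⟨R, hlarge⟩ : ∃ R, ∀ t, R < |t| → 2 * M ≤ η / 2 * |t| ^ q := by
    have h : Tendsto (fun x : ℝ => η / 2 * x ^ q) atTop atTop :=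
      (tendsto_rpow_atTop hq).const_mul_atTop (half_pos hη)
    obtain ⟨R, hR⟩ := eventually_atTop.1 (h.eventually_ge_atTop (2 * M))
    exact ⟨R, fun t ht => hR _ ht.le⟩
  obtain ⟨C, hC, hmid⟩ := exists_abs_sub_le_of_abs_le hf.continuous R (mul_pos hη hδ)
  refine ⟨C, hC, fun s t => ?_⟩
  have hs : 0 ≤ η * |s| ^ q := by positivity
  have ht : 0 ≤ η * |t| ^ q := by positivity
  have hs' : 0 ≤ η * |s| := by positivity
  have ht' : 0 ≤ η * |t| := by positivity
  have hst : 0 ≤ C * |s - t| := by positivity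
  have htri := abs_sub (f s) (f t)
  by_cases hR : R < |s| ∨ R < |t|
  · rcases hR with h | h <;> linarith [hlarge _ h, hbound s, hbound t]
  push Not at hR
  by_cases hδst : |s| < δ ∧ |t| < δ
  · linarith [hsmall s hδst.1, hsmall t hδst.2]
  · have hle : δ ≤ |s| + |t| := by
      by_contra! hcon
      exact hδst ⟨by linarith [abs_nonneg t], by linarith [abs_nonneg s]⟩
    nlinarith [hmid s t hR.1 hR.2]

theorem hasDerivAt_primitive (hf : Continuous f) (t : ℝ) :
    HasDerivAt (primitive f) (f t) t :=
  (hf.integral_hasStrictDerivAt 0 t).hasDerivAt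

theorem continuous_primitive (hf : Continuous f) : Continuous (primitive f) :=
  continuous_iff_continuousAt.2 fun t => (hasDerivAt_primitive hf t).continuousAt

theorem primitive_zero : primitive f 0 = 0 := by simp [primitive]

theorem add_rpow_le_two_rpow_mul {a b : ℝ} (ha : 0 ≤ a) (hb : 0 ≤ b) (hq : 0 ≤ q) :
    (a + b) ^ q ≤ 2 ^ q * (a ^ q + b ^ q) := by
  have hadd : a + b ≤ 2 * max a b := by linarith [le_max_left a b, le_max_right a b]
  have hmax : max a b ^ q ≤ a ^ q + b ^ q := by
    have := Real.rpow_nonneg ha q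
    have := Real.rpow_nonneg hb q
    rcases max_cases a b with h | h <;> rw [h.1] <;> linarith
  calc (a + b) ^ q ≤ (2 * max a b) ^ q := Real.rpow_le_rpow (by positivity) hadd hq
    _ = 2 ^ q * max a b ^ q := Real.mul_rpow two_pos.le (le_max_of_le_left ha)
    _ ≤ _ := by gcongr

theorem abs_le_add_of_mem_uIcc {a b ξ : ℝ} (hξ : ξ ∈ Set.uIcc a b) : |ξ| ≤ |a| + |b| := by
  rcases Set.mem_uIcc.1 hξ with h | h <;> rw [abs_le] <;> constructor <;>
    linarith [neg_abs_le a, neg_abs_le b, le_abs_self a, le_abs_self b, abs_nonneg a, abs_nonneg b]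

theorem IsSubcritical.exists_abs_sub_le_of_mem_uIcc (hf : IsSubcritical f q) (hq : 0 < q) {η : ℝ}
    (hη : 0 < η) : ∃ C : ℝ, 0 ≤ C ∧ ∀ a b : ℝ, ∀ ξ ∈ Set.uIcc a b,
      |f ξ - f a| ≤ η * (|a| + |b| + |a| ^ q + |b| ^ q) + C * |b - a| := by
  have h2q : (1 : ℝ) ≤ 2 ^ q := Real.one_le_rpow one_le_two hq.le
  obtain ⟨C, hC, h⟩ := hf.exists_abs_sub_le hq (η := η / (2 * 2 ^ q)) (by positivity)
  refine ⟨C, hC, fun a b ξ hξ => ?_⟩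
  have hξab : |ξ| ≤ |a| + |b| := abs_le_add_of_mem_uIcc hξ
  have haab : |a| ≤ |a| + |b| := le_add_of_nonneg_right (abs_nonneg b)
  have hadd := add_rpow_le_two_rpow_mul (abs_nonneg a) (abs_nonneg b) hq.le
  have hξq : |ξ| ^ q ≤ (|a| + |b|) ^ q := Real.rpow_le_rpow (abs_nonneg _) hξab hq.le
  have haq : |a| ^ q ≤ (|a| + |b|) ^ q := Real.rpow_le_rpow (abs_nonneg _) haab hq.le
  have hlin : |a| + |b| ≤ 2 ^ q * (|a| + |b|) := le_mul_of_one_le_left (by positivity) h2q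
  calc |f ξ - f a| ≤ η / (2 * 2 ^ q) * (|ξ| + |a| + |ξ| ^ q + |a| ^ q) + C * |ξ - a| := h ξ a
    _ ≤ η / (2 * 2 ^ q) * (2 * 2 ^ q * (|a| + |b| + |a| ^ q + |b| ^ q)) + C * |b - a| := by
      have hξa : |ξ - a| ≤ |b - a| := Set.abs_sub_left_of_mem_uIcc hξ
      gcongr
      linarith
    _ = η * (|a| + |b| + |a| ^ q + |b| ^ q) + C * |b - a| := by field_simp

theorem IsSubcritical.exists_primitive_remainder_le (hf : IsSubcritical f q) (hq : 0 < q) {η : ℝ}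
    (hη : 0 < η) : ∃ C : ℝ, 0 ≤ C ∧ ∀ a b : ℝ, |primitive f b - primitive f a - f a * (b - a)| ≤
      (η * (|a| + |b| + |a| ^ q + |b| ^ q) + C * |b - a|) * |b - a| := by
  obtain ⟨C, hC, h⟩ := hf.exists_abs_sub_le_of_mem_uIcc hq hη
  refine ⟨C, hC, fun a b => ?_⟩
  have hderiv : ∀ ξ, HasDerivAt (fun y => primitive f y - f a * y) (f ξ - f a) ξ := fun ξ =>
    ((hasDerivAt_primitive hf.continuous ξ).sub
      ((hasDerivAt_id ξ).const_mul (f a))).congr_deriv (by simp)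
  have hmvt := (convex_uIcc a b).norm_image_sub_le_of_norm_hasDerivWithin_le
    (fun ξ _ => (hderiv ξ).hasDerivWithinAt) (h a b) Set.left_mem_uIcc Set.right_mem_uIcc
  rw [Real.norm_eq_abs, Real.norm_eq_abs] at hmvt
  convert hmvt using 2
  ring

theorem hasDerivAt_rpow_neg_mul_primitive (hf : Continuous f) (μ x : ℝ) {t : ℝ} (ht : 0 < t) :
    HasDerivAt (fun t : ℝ => t ^ (-μ) * primitive f (t * x))
      (t ^ (-μ - 1) * (t * x * f (t * x) - μ * primitive f (t * x))) t := by
  have hprim : HasDerivAt (fun t => primitive f (t * x)) (f (t * x) * x) t :=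
    HasDerivAt.comp (h₂ := primitive f) t (hasDerivAt_primitive hf (t * x))
      (hasDerivAt_mul_const x)
  refine ((Real.hasDerivAt_rpow_const (p := -μ) (Or.inl ht.ne')).mul hprim).congr_deriv ?_
  rw [Real.rpow_sub_one ht.ne']
  field_simp
  ring

theorem AmbrosettiRabinowitz.rpow_mul_primitive_le {μ : ℝ} (hAR : AmbrosettiRabinowitz f μ)
    (hf : Continuous f) (x : ℝ) {s : ℝ} (hs : 1 ≤ s) :
    s ^ μ * primitive f x ≤ primitive f (s * x) := by
  rcases eq_or_ne x 0 with rfl | hx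
  · simp [primitive_zero]
  have hmono : MonotoneOn (fun t : ℝ => t ^ (-μ) * primitive f (t * x)) (Set.Ici 1) := by
    refine monotoneOn_of_hasDerivWithinAt_nonneg (convex_Ici 1)
      (fun t ht => (hasDerivAt_rpow_neg_mul_primitive hf μ x
        (one_pos.trans_le ht)).continuousAt.continuousWithinAt)
      (fun t ht => (hasDerivAt_rpow_neg_mul_primitive hf μ x
        (one_pos.trans_le (interior_subset ht))).hasDerivWithinAt) fun t ht => ?_
    have ht0 : 0 < t := one_pos.trans_le (interior_subset ht)
    exact mul_nonneg (by positivity) (sub_nonneg.2 (hAR _ (mul_ne_zero ht0.ne' hx)).2)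
  have hle := hmono Set.self_mem_Ici hs hs
  have hs0 : 0 < s := one_pos.trans_le hs
  simp only [Real.one_rpow, one_mul] at hle
  rwa [Real.rpow_neg hs0.le, inv_mul_eq_div, le_div_iff₀' (by positivity)] at hle

theorem growthConst_nonneg {δ ρ : ℝ} (hδ : 0 ≤ δ) : 0 ≤ growthConst f q δ ρ :=
  mul_nonneg (by positivity) (Real.sSup_nonneg (by rintro _ ⟨t, -, rfl⟩; exact abs_nonneg _))

theorem abs_le_growthConst_mul_rpow (hf : Continuous f) (hq : 0 ≤ q) {δ ρ : ℝ} (hδ : 0 < δ) {t : ℝ}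
    (ht : δ ≤ |t|) (ht' : |t| ≤ ρ) : |f t| ≤ growthConst f q δ ρ * |t| ^ q := by
  have hcompact : IsCompact {t : ℝ | δ ≤ |t| ∧ |t| ≤ ρ} :=
    (isCompact_Icc (a := -ρ) (b := ρ)).of_isClosed_subset
      ((isClosed_le continuous_const continuous_abs).inter
        (isClosed_le continuous_abs continuous_const)) fun t ht => abs_le.1 ht.2
  have hsup : |f t| ≤ sSup ((fun t => |f t|) '' {t : ℝ | δ ≤ |t| ∧ |t| ≤ ρ}) :=
    le_csSup (hcompact.image hf.abs).bddAbove ⟨t, ⟨ht, ht'⟩, rfl⟩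
  have hone : 1 ≤ δ ^ (-q) * |t| ^ q := by
    rw [Real.rpow_neg hδ.le, inv_mul_eq_div, one_le_div (by positivity)]
    exact Real.rpow_le_rpow hδ.le ht hq
  rw [growthConst, mul_right_comm]
  exact hsup.trans (le_mul_of_one_le_left ((abs_nonneg _).trans hsup) hone)

theorem abs_le_of_growth (hf : Continuous f) (hq : 0 ≤ q) {ε δ ρ : ℝ} (hε : 0 ≤ ε) (hδ : 0 < δ)
    (hfδ : ∀ t : ℝ, |t| ≤ δ → |f t| ≤ ε * |t|)
    (hfρ : ∀ t : ℝ, ρ ≤ |t| → |f t| ≤ ε * |t| ^ q) (t : ℝ) :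
    |f t| ≤ ε * |t| + (ε + growthConst f q δ ρ) * |t| ^ q := by
  have hK : 0 ≤ growthConst f q δ ρ * |t| ^ q :=
    mul_nonneg (growthConst_nonneg hδ.le) (by positivity)
  have hlin : 0 ≤ ε * |t| := by positivity
  have hpow : 0 ≤ ε * |t| ^ q := by positivity
  rw [add_mul]
  rcases le_or_gt |t| δ with h | h
  · linarith [hfδ t h]
  rcases le_or_gt ρ |t| with h' | h'
  · linarith [hfρ t h']
  · linarith [abs_le_growthConst_mul_rpow hf hq hδ h.le h'.le]

theorem abs_primitive_le (hf : Continuous f) (hq : 0 ≤ q) {a b : ℝ} (ha : 0 ≤ a) (hb : 0 ≤ b)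
    (h : ∀ t, |f t| ≤ a * |t| + b * |t| ^ q) (t : ℝ) :
    |primitive f t| ≤ (a * |t| + b * |t| ^ q) * |t| := by
  have hmvt := (convex_uIcc 0 t).norm_image_sub_le_of_norm_hasDerivWithin_le
    (f := primitive f) (f' := f) (C := a * |t| + b * |t| ^ q)
    (fun ξ _ => (hasDerivAt_primitive hf ξ).hasDerivWithinAt)
    (fun ξ hξ => by
      have hξt : |ξ| ≤ |t| := by simpa using Set.abs_sub_left_of_mem_uIcc hξ
      refine (h ξ).trans ?_
      gcongr) Set.left_mem_uIcc Set.right_mem_uIcc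
  simpa [primitive_zero] using hmvt

end Nonlinearity

section Nemytskii

variable {X : Type*} [MeasurableSpace X] {ν : Measure X}

theorem integrable_abs_mul_abs (u w : Lp ℝ 2 ν) : Integrable (fun x => |u x| * |w x|) ν :=
  (Lp.memLp u).abs.integrable_mul (Lp.memLp w).abs

theorem integral_abs_mul_abs_le (u w : Lp ℝ 2 ν) : ∫ x, |u x| * |w x| ∂ν ≤ ‖u‖ * ‖w‖ := by
  have hinner : ∫ x, |u x| * |w x| ∂ν = inner ℝ |u| |w| := by
    rw [L2.inner_def]
    refine integral_congr_ae ?_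
    filter_upwards [Lp.coeFn_abs u, Lp.coeFn_abs w] with x hu hw
    rw [hu, hw, real_inner_eq_re_inner, RCLike.inner_apply]
    simp [mul_comm]
  rw [hinner, ← norm_abs_eq_norm u, ← norm_abs_eq_norm w]
  exact real_inner_le_norm _ _

theorem eLpNorm_rpow_mul_le {s : ℝ} (hs : 0 < s) {u w : X → ℝ} (hu : AEStronglyMeasurable u ν)
    (hw : AEStronglyMeasurable w ν) :
    eLpNorm (fun x => |u x| ^ s * |w x|) 1 ν ≤
      eLpNorm u (ENNReal.ofReal (s + 1)) ν ^ s * eLpNorm w (ENNReal.ofReal (s + 1)) ν := by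
  have hconj : (ENNReal.ofReal ((s + 1) / s)).HolderConjugate (ENNReal.ofReal (s + 1)) := by
    refine Real.HolderConjugate.ennrealOfReal ?_
    rw [Real.holderConjugate_iff]
    refine ⟨by rw [lt_div_iff₀ hs]; linarith, ?_⟩
    field_simp
  have hpow : eLpNorm (fun x => |u x| ^ s) (ENNReal.ofReal ((s + 1) / s)) ν =
      eLpNorm u (ENNReal.ofReal (s + 1)) ν ^ s := by
    have h := eLpNorm_norm_rpow (μ := ν) (p := ENNReal.ofReal ((s + 1) / s)) u hs
    rwa [← ENNReal.ofReal_mul (by positivity), div_mul_cancel₀ _ hs.ne'] at h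
  have hnorm : eLpNorm (fun x => |w x|) (ENNReal.ofReal (s + 1)) ν =
      eLpNorm w (ENNReal.ofReal (s + 1)) ν := eLpNorm_norm w
  rw [← hpow, ← hnorm]
  exact eLpNorm_smul_le_mul_eLpNorm (𝕜 := ℝ) hw.norm
    ((Real.continuous_rpow_const hs.le).comp_aestronglyMeasurable hu.norm)

variable {H : Type*} [NormedAddCommGroup H] [InnerProductSpace ℝ H]

/-- `J` embeds `H` into `L² ∩ L^{q+1}` with constant `C` in both norms. The elements of `H` are
represented by their images in `L²`, so that pointwise statements about `u` are made for `J u`. -/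
structure IsSobolevEmbedding (J : H →L[ℝ] Lp ℝ 2 ν) (q C : ℝ) : Prop where
  nonneg : 0 ≤ C
  norm_le : ∀ u, ‖J u‖ ≤ C * ‖u‖
  eLpNorm_le : ∀ u, eLpNorm (J u) (ENNReal.ofReal (q + 1)) ν ≤ ENNReal.ofReal (C * ‖u‖)

theorem isClosed_setOf_isSobolevEmbedding (J : H →L[ℝ] Lp ℝ 2 ν) (q : ℝ) :
    IsClosed {C | IsSobolevEmbedding J q C} := by
  have hset : {C | IsSobolevEmbedding J q C} = {C | 0 ≤ C} ∩ ({C | ∀ u, ‖J u‖ ≤ C * ‖u‖} ∩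
      {C | ∀ u, eLpNorm (J u) (ENNReal.ofReal (q + 1)) ν ≤ ENNReal.ofReal (C * ‖u‖)}) :=
    Set.ext fun C => ⟨fun h => ⟨h.1, h.2, h.3⟩, fun h => ⟨h.1, h.2.1, h.2.2⟩⟩
  simp only [hset, Set.ofPred_forall]
  exact isClosed_Ici.inter ((isClosed_iInter fun u => isClosed_le (by fun_prop) (by fun_prop)).inter
    (isClosed_iInter fun u => isClosed_le (by fun_prop)
      (ENNReal.continuous_ofReal.comp (by fun_prop))))

variable {J : H →L[ℝ] Lp ℝ 2 ν} {q C : ℝ}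

namespace IsSobolevEmbedding

theorem eLpNorm_rpow_mul_le (hJ : IsSobolevEmbedding J q C) (hq : 0 < q) (u w : H) :
    eLpNorm (fun x => |J u x| ^ q * |J w x|) 1 ν ≤
      ENNReal.ofReal ((C * ‖u‖) ^ q * (C * ‖w‖)) := by
  have hC := hJ.nonneg
  refine (FracSchrodinger.eLpNorm_rpow_mul_le hq (Lp.aestronglyMeasurable (J u))
    (Lp.aestronglyMeasurable (J w))).trans ?_
  rw [ENNReal.ofReal_mul (by positivity), ← ENNReal.ofReal_rpow_of_nonneg (by positivity) hq.le]
  gcongr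
  · exact hJ.eLpNorm_le u
  · exact hJ.eLpNorm_le w

theorem integrable_rpow_mul (hJ : IsSobolevEmbedding J q C) (hq : 0 < q) (u w : H) :
    Integrable (fun x => |J u x| ^ q * |J w x|) ν :=
  memLp_one_iff_integrable.1 ⟨((Real.continuous_rpow_const hq.le).comp_aestronglyMeasurable
    (Lp.aestronglyMeasurable (J u)).norm).mul (Lp.aestronglyMeasurable (J w)).norm,
    (hJ.eLpNorm_rpow_mul_le hq u w).trans_lt ENNReal.ofReal_lt_top⟩

theorem integral_rpow_mul_le (hJ : IsSobolevEmbedding J q C) (hq : 0 < q) (u w : H) :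
    ∫ x, |J u x| ^ q * |J w x| ∂ν ≤ (C * ‖u‖) ^ q * (C * ‖w‖) := by
  have hC := hJ.nonneg
  rw [← ENNReal.ofReal_le_ofReal_iff (by positivity),
    ofReal_integral_eq_lintegral_ofReal (hJ.integrable_rpow_mul hq u w)
      (Eventually.of_forall fun x => by positivity)]
  refine le_trans (le_of_eq ?_) (hJ.eLpNorm_rpow_mul_le hq u w)
  rw [eLpNorm_one_eq_lintegral_enorm]
  exact lintegral_congr fun x => (Real.enorm_of_nonneg (by positivity)).symm

theorem integrable_growth (hJ : IsSobolevEmbedding J q C) (hq : 0 < q) (a b : ℝ) (u w : H) :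
    Integrable (fun x => (a * |J u x| + b * |J u x| ^ q) * |J w x|) ν := by
  refine (((integrable_abs_mul_abs (J u) (J w)).const_mul a).add
    ((hJ.integrable_rpow_mul hq u w).const_mul b)).congr (Eventually.of_forall fun x => ?_)
  simp only [Pi.add_apply]
  ring

theorem integral_growth_le (hJ : IsSobolevEmbedding J q C) (hq : 0 < q) {a b R : ℝ} (ha : 0 ≤ a)
    (hb : 0 ≤ b) {u : H} (hu : ‖u‖ ≤ R) (w : H) :
    ∫ x, (a * |J u x| + b * |J u x| ^ q) * |J w x| ∂ν ≤
      (a * (C * R) + b * (C * R) ^ q) * (C * ‖w‖) := by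
  have hC := hJ.nonneg
  have hCR : C * ‖u‖ ≤ C * R := by gcongr
  calc ∫ x, (a * |J u x| + b * |J u x| ^ q) * |J w x| ∂ν
      = a * (∫ x, |J u x| * |J w x| ∂ν) + b * ∫ x, |J u x| ^ q * |J w x| ∂ν := by
        rw [← integral_const_mul, ← integral_const_mul, ← integral_add
          ((integrable_abs_mul_abs _ _).const_mul a) ((hJ.integrable_rpow_mul hq u w).const_mul b)]
        exact integral_congr_ae (Eventually.of_forall fun x => by ring)
    _ ≤ a * (‖J u‖ * ‖J w‖) + b * ((C * ‖u‖) ^ q * (C * ‖w‖)) := by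
        gcongr
        · exact integral_abs_mul_abs_le _ _
        · exact hJ.integral_rpow_mul_le hq u w
    _ ≤ a * ((C * R) * (C * ‖w‖)) + b * ((C * R) ^ q * (C * ‖w‖)) := by
        gcongr
        · exact (norm_nonneg _).trans ((hJ.norm_le u).trans hCR)
        · exact (hJ.norm_le u).trans hCR
        · exact hJ.norm_le w
    _ = _ := by ring

theorem integral_le_of_abs_le (hJ : IsSobolevEmbedding J q C) (hq : 0 < q) {η K R : ℝ}
    (hη : 0 ≤ η) (hK : 0 ≤ K) {u v w : H} (hu : ‖u‖ ≤ R) (hv : ‖v‖ ≤ R) {k : X → ℝ}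
    (hk : AEStronglyMeasurable k ν) (hle : ∀ᵐ x ∂ν, |k x| ≤
      (η * (|J u x| + |J v x| + |J u x| ^ q + |J v x| ^ q) + K * |J (u - v) x|) * |J w x|) :
    Integrable k ν ∧ |∫ x, k x ∂ν| ≤
      η * (2 * ((C * R) + (C * R) ^ q) * C) * ‖w‖ + K * (‖J (u - v)‖ * ‖J w‖) := by
  have hgu := hJ.integrable_growth hq η η u w
  have hgv := hJ.integrable_growth hq η η v w
  have hd := (integrable_abs_mul_abs (J (u - v)) (J w)).const_mul K
  have hle' : ∀ᵐ x ∂ν, |k x| ≤ (η * |J u x| + η * |J u x| ^ q) * |J w x| +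
      (η * |J v x| + η * |J v x| ^ q) * |J w x| + K * (|J (u - v) x| * |J w x|) := by
    filter_upwards [hle] with x hx
    exact hx.trans_eq (by ring)
  have hint : Integrable k ν := ((hgu.add hgv).add hd).mono' hk hle'
  refine ⟨hint, abs_integral_le_integral_abs.trans
    ((integral_mono_ae hint.abs ((hgu.add hgv).add hd) hle').trans ?_)⟩
  rw [integral_add' (hgu.add hgv) hd, integral_add' hgu hgv, integral_const_mul]
  have hKd := mul_le_mul_of_nonneg_left (integral_abs_mul_abs_le (J (u - v)) (J w)) hK
  linarith [hJ.integral_growth_le hq hη hη hu w, hJ.integral_growth_le hq hη hη hv w]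

/-- Absorbs the constants of the embedding into the small factor of a pointwise estimate. -/
theorem exists_pos_forall_integral_le (hJ : IsSobolevEmbedding J q C) (hq : 0 < q) (R : ℝ) {η : ℝ}
    (hη : 0 < η) : ∃ κ > 0, ∀ K, 0 ≤ K → ∀ u v w : H, ‖u‖ ≤ R → ‖v‖ ≤ R → ∀ k : X → ℝ,
      AEStronglyMeasurable k ν → (∀ᵐ x ∂ν, |k x| ≤
        (κ * (|J u x| + |J v x| + |J u x| ^ q + |J v x| ^ q) + K * |J (u - v) x|) * |J w x|) →
      Integrable k ν ∧ |∫ x, k x ∂ν| ≤ η * ‖w‖ + K * (‖J (u - v)‖ * ‖J w‖) := by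
  obtain ⟨κ, hκ, hlt⟩ := exists_pos_mul_lt hη (2 * ((C * R) + (C * R) ^ q) * C)
  refine ⟨κ, hκ, fun K hK u v w hu hv k hk hle => ?_⟩
  obtain ⟨hint, hbound⟩ := hJ.integral_le_of_abs_le hq hκ.le hK hu hv hk hle
  refine ⟨hint, hbound.trans ?_⟩
  rw [mul_comm κ]
  gcongr

end IsSobolevEmbedding

/-- The nonlinear part `∫ F(u)` of the energy, where `F` is the primitive of `f`. -/
noncomputable def potential (f : ℝ → ℝ) (J : H →L[ℝ] Lp ℝ 2 ν) (u : H) : ℝ :=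
  ∫ x, primitive f (J u x) ∂ν

theorem coeFn_map_zero (J : H →L[ℝ] Lp ℝ 2 ν) : J 0 =ᵐ[ν] 0 := by
  rw [map_zero]
  exact Lp.coeFn_zero ℝ 2 ν

theorem coeFn_map_sub (J : H →L[ℝ] Lp ℝ 2 ν) (u v : H) : J (u - v) =ᵐ[ν] J u - J v := by
  rw [map_sub]
  exact Lp.coeFn_sub _ _

variable {f : ℝ → ℝ}

theorem potential_zero : potential f J 0 = 0 := by
  refine integral_eq_zero_of_ae ?_
  filter_upwards [coeFn_map_zero J] with x hx
  rw [hx, Pi.zero_apply, primitive_zero]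

namespace IsSobolevEmbedding

theorem exists_nemytskii_sub_le (hJ : IsSobolevEmbedding J q C) (hf : IsSubcritical f q)
    (hq : 0 < q) (R : ℝ) {η : ℝ} (hη : 0 < η) :
    ∃ K, 0 ≤ K ∧ ∀ u v w : H, ‖u‖ ≤ R → ‖v‖ ≤ R →
      Integrable (fun x => (f (J u x) - f (J v x)) * J w x) ν ∧
      |∫ x, (f (J u x) - f (J v x)) * J w x ∂ν| ≤ η * ‖w‖ + K * (‖J (u - v)‖ * ‖J w‖) := by
  obtain ⟨κ, hκ, hint⟩ := hJ.exists_pos_forall_integral_le hq R hη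
  obtain ⟨K, hK, hsub⟩ := hf.exists_abs_sub_le hq hκ
  have hmeas : ∀ u, AEStronglyMeasurable (fun x => f (J u x)) ν := fun u =>
    hf.continuous.comp_aestronglyMeasurable (Lp.aestronglyMeasurable _)
  refine ⟨K, hK, fun u v w hu hv => hint K hK u v w hu hv _
    (((hmeas u).sub (hmeas v)).mul (Lp.aestronglyMeasurable _)) ?_⟩
  filter_upwards [coeFn_map_sub J u v] with x hx
  rw [abs_mul, hx, Pi.sub_apply]
  gcongr
  exact hsub _ _

theorem exists_nemytskii_le (hJ : IsSobolevEmbedding J q C) (hf : IsSubcritical f q) (hq : 0 < q)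
    (u : H) : ∃ K, ∀ w : H,
      Integrable (fun x => f (J u x) * J w x) ν ∧ |∫ x, f (J u x) * J w x ∂ν| ≤ K * ‖w‖ := by
  obtain ⟨K, hK, hsub⟩ := hJ.exists_nemytskii_sub_le hf hq ‖u‖ one_pos
  refine ⟨1 + K * (‖J u‖ * C), fun w => ?_⟩
  have hae : (fun x => (f (J u x) - f (J 0 x)) * J w x) =ᵐ[ν] fun x => f (J u x) * J w x := by
    filter_upwards [coeFn_map_zero J] with x hx
    rw [hx, Pi.zero_apply, hf.apply_zero, sub_zero]
  obtain ⟨hint, hle⟩ := hsub u 0 w le_rfl (by simp)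
  rw [integral_congr_ae hae, sub_zero] at hle
  refine ⟨hint.congr hae, hle.trans ?_⟩
  calc 1 * ‖w‖ + K * (‖J u‖ * ‖J w‖) ≤ 1 * ‖w‖ + K * (‖J u‖ * (C * ‖w‖)) := by
        gcongr
        exact hJ.norm_le w
    _ = (1 + K * (‖J u‖ * C)) * ‖w‖ := by ring

theorem integrable_nemytskii_mul (hJ : IsSobolevEmbedding J q C) (hf : IsSubcritical f q)
    (hq : 0 < q) (u w : H) : Integrable (fun x => f (J u x) * J w x) ν :=
  let ⟨_, hK⟩ := hJ.exists_nemytskii_le hf hq u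
  (hK w).1

theorem integrable_primitive (hJ : IsSobolevEmbedding J q C) (hf : IsSubcritical f q)
    (hq : 0 < q) (u : H) : Integrable (fun x => primitive f (J u x)) ν := by
  obtain ⟨K, -, hrem⟩ := hf.exists_primitive_remainder_le hq one_pos
  refine (hJ.integrable_growth hq (1 + K) 1 u u).mono'
    ((continuous_primitive hf.continuous).comp_aestronglyMeasurable (Lp.aestronglyMeasurable _))
    (Eventually.of_forall fun x => ?_)
  have h := hrem 0 (J u x)
  simp only [primitive_zero, hf.apply_zero, sub_zero, zero_mul, abs_zero, zero_add,
    Real.zero_rpow hq.ne', one_mul, add_zero] at h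
  exact h.trans_eq (by ring)

theorem exists_potential_remainder_le (hJ : IsSobolevEmbedding J q C) (hf : IsSubcritical f q)
    (hq : 0 < q) (R : ℝ) {η : ℝ} (hη : 0 < η) : ∃ K, 0 ≤ K ∧ ∀ u v : H, ‖u‖ ≤ R → ‖v‖ ≤ R →
      |potential f J v - potential f J u - ∫ x, f (J u x) * J (v - u) x ∂ν| ≤
        η * ‖v - u‖ + K * ‖J (v - u)‖ ^ 2 := by
  obtain ⟨κ, hκ, hint⟩ := hJ.exists_pos_forall_integral_le hq R hη
  obtain ⟨K, hK, hrem⟩ := hf.exists_primitive_remainder_le hq hκ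
  refine ⟨K, hK, fun u v hu hv => ?_⟩
  have hFu := hJ.integrable_primitive hf hq u
  have hFv := hJ.integrable_primitive hf hq v
  have hfu := hJ.integrable_nemytskii_mul hf hq u (v - u)
  have hle := (hint K hK v u (v - u) hv hu _ ((hFv.sub hFu).sub hfu).aestronglyMeasurable ?_).2
  · rwa [integral_sub' (hFv.sub hFu) hfu, integral_sub' hFv hFu, ← sq] at hle
  · filter_upwards [coeFn_map_sub J v u] with x hx
    simp only [Pi.sub_apply, hx]
    exact (hrem _ _).trans_eq (by ring)

end IsSobolevEmbedding

theorem hasGradientAt_of_remainder_le [CompleteSpace H] {P : H → ℝ} {a u : H}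
    (h : ∀ η > 0, ∃ K, ∀ᶠ v in 𝓝 u,
      |P v - P u - inner ℝ a (v - u)| ≤ η * ‖v - u‖ + K * ‖v - u‖ ^ 2) : HasGradientAt P a u := by
  rw [hasGradientAt_iff_isLittleO, isLittleO_iff]
  intro c hc
  obtain ⟨K, hK⟩ := h (c / 2) (half_pos hc)
  have hsmall : ∀ᶠ v in 𝓝 u, K * ‖v - u‖ < c / 2 := by
    have hcont : Continuous fun v => K * ‖v - u‖ := by fun_prop
    exact hcont.continuousAt.eventually_lt_const (by simpa using half_pos hc)
  filter_upwards [hK, hsmall] with v hv hv'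
  rw [Real.norm_eq_abs]
  nlinarith [norm_nonneg (v - u)]

namespace IsSobolevEmbedding

variable [CompleteSpace H]

theorem exists_inner_eq_integral_nemytskii (hJ : IsSobolevEmbedding J q C)
    (hf : IsSubcritical f q) (hq : 0 < q) (u : H) :
    ∃ a : H, ∀ w, inner ℝ a w = ∫ x, f (J u x) * J w x ∂ν := by
  obtain ⟨K, hK⟩ := hJ.exists_nemytskii_le hf hq u
  let ℓ : H →ₗ[ℝ] ℝ :=
    { toFun := fun w => ∫ x, f (J u x) * J w x ∂ν
      map_add' := fun w w' => by
        rw [← integral_add (hK w).1 (hK w').1]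
        refine integral_congr_ae ?_
        filter_upwards [(map_add J w w').symm ▸ Lp.coeFn_add (J w) (J w')] with x hx
        rw [hx, Pi.add_apply, mul_add]
      map_smul' := fun c w => by
        rw [RingHom.id_apply, smul_eq_mul, ← integral_const_mul]
        refine integral_congr_ae ?_
        filter_upwards [(map_smul J c w).symm ▸ Lp.coeFn_smul c (J w)] with x hx
        rw [hx, Pi.smul_apply, smul_eq_mul, mul_left_comm] }
  let L : H →L[ℝ] ℝ := ℓ.mkContinuous K fun w => (hK w).2
  exact ⟨(InnerProductSpace.toDual ℝ H).symm L, fun w => InnerProductSpace.toDual_symm_apply⟩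

theorem exists_hasGradientAt_potential (hJ : IsSobolevEmbedding J q C) (hf : IsSubcritical f q)
    (hq : 0 < q) (u : H) : ∃ a : H, HasGradientAt (potential f J) a u ∧
      ∀ w, inner ℝ a w = ∫ x, f (J u x) * J w x ∂ν := by
  obtain ⟨a, ha⟩ := hJ.exists_inner_eq_integral_nemytskii hf hq u
  refine ⟨a, hasGradientAt_of_remainder_le fun η hη => ?_, ha⟩
  obtain ⟨K, hK, hrem⟩ := hJ.exists_potential_remainder_le hf hq (‖u‖ + 1) hη
  refine ⟨K * C ^ 2, ?_⟩
  have hball : ∀ᶠ v in 𝓝 u, ‖v‖ < ‖u‖ + 1 :=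
    continuous_norm.continuousAt.eventually_lt_const (lt_add_one _)
  filter_upwards [hball] with v hv
  rw [ha]
  refine (hrem u v (by linarith) hv.le).trans ?_
  rw [mul_assoc, ← mul_pow]
  gcongr
  exact hJ.norm_le _

theorem hasGradientAt_potential (hJ : IsSobolevEmbedding J q C) (hf : IsSubcritical f q)
    (hq : 0 < q) (u : H) : HasGradientAt (potential f J) (∇ (potential f J) u) u :=
  let ⟨_, ha, _⟩ := hJ.exists_hasGradientAt_potential hf hq u
  ha.differentiableAt.hasGradientAt

theorem inner_gradient_potential (hJ : IsSobolevEmbedding J q C) (hf : IsSubcritical f q)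
    (hq : 0 < q) (u w : H) :
    inner ℝ (∇ (potential f J) u) w = ∫ x, f (J u x) * J w x ∂ν := by
  obtain ⟨a, ha, hinner⟩ := hJ.exists_hasGradientAt_potential hf hq u
  rw [ha.gradient, hinner]

theorem exists_norm_gradient_potential_sub_le (hJ : IsSobolevEmbedding J q C)
    (hf : IsSubcritical f q) (hq : 0 < q) (R : ℝ) {η : ℝ} (hη : 0 < η) :
    ∃ K, 0 ≤ K ∧ ∀ u v : H, ‖u‖ ≤ R → ‖v‖ ≤ R →
      ‖∇ (potential f J) u - ∇ (potential f J) v‖ ≤ η + K * ‖J u - J v‖ := by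
  have hC := hJ.nonneg
  obtain ⟨K, hK, hsub⟩ := hJ.exists_nemytskii_sub_le hf hq R hη
  refine ⟨K * C, by positivity, fun u v hu hv => ?_⟩
  set d := ∇ (potential f J) u - ∇ (potential f J) v with hd
  have hinner : ‖d‖ ^ 2 = ∫ x, (f (J u x) - f (J v x)) * J d x ∂ν := by
    rw [← real_inner_self_eq_norm_sq]
    nth_rewrite 1 [hd]
    rw [inner_sub_left, hJ.inner_gradient_potential hf hq,
      hJ.inner_gradient_potential hf hq, ← integral_sub (hJ.integrable_nemytskii_mul hf hq u d)
        (hJ.integrable_nemytskii_mul hf hq v d)]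
    simp_rw [sub_mul]
  have hle : ‖d‖ * ‖d‖ ≤ (η + K * C * ‖J u - J v‖) * ‖d‖ := by
    calc ‖d‖ * ‖d‖ ≤ η * ‖d‖ + K * (‖J (u - v)‖ * ‖J d‖) := by
          rw [← sq, hinner]
          exact (le_abs_self _).trans (hsub u v d hu hv).2
      _ ≤ η * ‖d‖ + K * (‖J (u - v)‖ * (C * ‖d‖)) := by
          gcongr
          exact hJ.norm_le d
      _ = (η + K * C * ‖J u - J v‖) * ‖d‖ := by rw [map_sub]; ring
  rcases (norm_nonneg d).eq_or_lt with h0 | h0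
  · rw [← h0]
    positivity
  · exact le_of_mul_le_mul_right hle h0

theorem continuous_gradient_potential (hJ : IsSobolevEmbedding J q C) (hf : IsSubcritical f q)
    (hq : 0 < q) : Continuous (∇ (potential f J)) := by
  refine continuous_iff_continuousAt.2 fun u => Metric.tendsto_nhds.2 fun ε hε => ?_
  obtain ⟨K, -, hsub⟩ := hJ.exists_norm_gradient_potential_sub_le hf hq (‖u‖ + 1) (half_pos hε)
  have hball : ∀ᶠ v in 𝓝 u, ‖v‖ < ‖u‖ + 1 :=
    continuous_norm.continuousAt.eventually_lt_const (lt_add_one _)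
  have hsmall : ∀ᶠ v in 𝓝 u, K * ‖J v - J u‖ < ε / 2 := by
    have hcont : Continuous fun v => K * ‖J v - J u‖ := by fun_prop
    exact hcont.continuousAt.eventually_lt_const (by simpa using half_pos hε)
  filter_upwards [hball, hsmall] with v hv hv'
  rw [dist_eq_norm]
  linarith [hsub v u hv.le (by linarith)]

theorem exists_subseq_tendsto_gradient_potential (hJ : IsSobolevEmbedding J q C)
    (hf : IsSubcritical f q) (hq : 0 < q) (hcompact : IsCompactOperator J) {u : ℕ → H} {R : ℝ}
    (hu : ∀ k, ‖u k‖ ≤ R) : ∃ (a : H) (φ : ℕ → ℕ), StrictMono φ ∧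
      Tendsto (fun k => ∇ (potential f J) (u (φ k))) atTop (𝓝 a) := by
  obtain ⟨S, hS, hsub⟩ := hcompact.image_closedBall_subset_compact R
  obtain ⟨y, -, φ, hφ, hy⟩ := hS.tendsto_subseq (x := fun k => J (u k))
    fun k => hsub ⟨u k, by simpa using hu k, rfl⟩
  have hcauchy : CauchySeq fun k => ∇ (potential f J) (u (φ k)) := by
    refine Metric.cauchySeq_iff.2 fun ε hε => ?_
    obtain ⟨K, hK, hle⟩ := hJ.exists_norm_gradient_potential_sub_le hf hq R (half_pos hε)
    obtain ⟨δ, hδ, hδK⟩ := exists_pos_mul_lt (half_pos hε) K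
    obtain ⟨M, hM⟩ := Metric.cauchySeq_iff.1 hy.cauchySeq δ hδ
    refine ⟨M, fun i hi j hj => ?_⟩
    have hij : ‖J (u (φ i)) - J (u (φ j))‖ < δ := by
      rw [← dist_eq_norm]
      exact hM i hi j hj
    rw [dist_eq_norm]
    linarith [hle _ _ (hu (φ i)) (hu (φ j)), mul_le_mul_of_nonneg_left hij.le hK]
  obtain ⟨a, ha⟩ := cauchySeq_tendsto_of_complete hcauchy
  exact ⟨a, φ, hφ, ha⟩

end IsSobolevEmbedding

end Nemytskii

section SemilinearEnergy

variable {X : Type*} [MeasurableSpace X] {ν : Measure X} {H : Type*} [NormedAddCommGroup H]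
  [InnerProductSpace ℝ H] {J : H →L[ℝ] Lp ℝ 2 ν} {q C : ℝ} {f : ℝ → ℝ} {ξ : H}

/-- The energy `½‖u‖² - ∫ F(u) - ⟨ξ, u⟩` on an abstract Hilbert space; the source term of the
equation enters through the vector `ξ` representing it. -/
noncomputable def semilinearEnergy (f : ℝ → ℝ) (J : H →L[ℝ] Lp ℝ 2 ν) (ξ u : H) : ℝ :=
  ‖u‖ ^ 2 / 2 - potential f J u - inner ℝ ξ u

theorem semilinearEnergy_zero : semilinearEnergy f J ξ 0 = 0 := by
  simp [semilinearEnergy, potential_zero]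

theorem hasGradientAt_half_norm_sq [CompleteSpace H] (u : H) :
    HasGradientAt (fun v : H => ‖v‖ ^ 2 / 2) u u := by
  refine hasGradientAt_of_remainder_le fun η hη => ⟨1 / 2, Eventually.of_forall fun v => ?_⟩
  have hexp : ‖v‖ ^ 2 / 2 - ‖u‖ ^ 2 / 2 - inner ℝ u (v - u) = 1 / 2 * ‖v - u‖ ^ 2 := by
    have h := norm_add_sq_real u (v - u)
    rw [add_sub_cancel] at h
    linarith
  rw [hexp, abs_of_nonneg (by positivity)]
  exact le_add_of_nonneg_left (by positivity)

theorem hasGradientAt_inner_left [CompleteSpace H] (ξ u : H) :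
    HasGradientAt (fun v : H => inner ℝ ξ v) ξ u :=
  (innerSL ℝ ξ).hasFDerivAt

namespace IsSobolevEmbedding

theorem abs_potential_le (hJ : IsSobolevEmbedding J q C) (hf : IsSubcritical f q) (hq : 0 < q)
    {a b r : ℝ} (ha : 0 ≤ a) (hb : 0 ≤ b) (hgrowth : ∀ t, |f t| ≤ a * |t| + b * |t| ^ q) {u : H}
    (hu : ‖u‖ ≤ r) : |potential f J u| ≤ (a * (C * r) + b * (C * r) ^ q) * (C * r) := by
  have hC := hJ.nonneg
  have hr : 0 ≤ r := (norm_nonneg u).trans hu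
  calc |potential f J u|
      ≤ ∫ x, (a * |J u x| + b * |J u x| ^ q) * |J u x| ∂ν :=
        abs_integral_le_integral_abs.trans
          (integral_mono (hJ.integrable_primitive hf hq u).abs (hJ.integrable_growth hq a b u u)
            fun x => abs_primitive_le hf.continuous hq.le ha hb hgrowth (J u x))
    _ ≤ (a * (C * r) + b * (C * r) ^ q) * (C * ‖u‖) := hJ.integral_growth_le hq ha hb hu u
    _ ≤ (a * (C * r) + b * (C * r) ^ q) * (C * r) := by gcongr

theorem sub_le_semilinearEnergy (hJ : IsSobolevEmbedding J q C) (hf : IsSubcritical f q)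
    (hq : 0 < q) {a b r : ℝ} (ha : 0 ≤ a) (hb : 0 ≤ b)
    (hgrowth : ∀ t, |f t| ≤ a * |t| + b * |t| ^ q) {u : H} (hu : ‖u‖ ≤ r) :
    ‖u‖ ^ 2 / 2 - (a * (C * r) + b * (C * r) ^ q) * (C * r) - ‖ξ‖ * r ≤
      semilinearEnergy f J ξ u := by
  have hpot := (abs_le.1 (hJ.abs_potential_le hf hq ha hb hgrowth hu)).2
  have hinner : inner ℝ ξ u ≤ ‖ξ‖ * r := (real_inner_le_norm ξ u).trans (by gcongr)
  unfold semilinearEnergy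
  linarith

theorem bddBelow_semilinearEnergy (hJ : IsSobolevEmbedding J q C) (hf : IsSubcritical f q)
    (hq : 0 < q) {a b : ℝ} (ha : 0 ≤ a) (hb : 0 ≤ b)
    (hgrowth : ∀ t, |f t| ≤ a * |t| + b * |t| ^ q) (r : ℝ) :
    BddBelow (semilinearEnergy f J ξ '' Metric.closedBall 0 r) := by
  refine ⟨-((a * (C * r) + b * (C * r) ^ q) * (C * r)) - ‖ξ‖ * r, ?_⟩
  rintro _ ⟨u, hu, rfl⟩
  have h := hJ.sub_le_semilinearEnergy (ξ := ξ) hf hq ha hb hgrowth (mem_closedBall_zero_iff.1 hu)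
  linarith [sq_nonneg ‖u‖]

theorem le_semilinearEnergy_of_norm_eq (hJ : IsSobolevEmbedding J q C) (hf : IsSubcritical f q)
    (hq : 0 < q) {a b r : ℝ} (ha : 0 ≤ a) (hb : 0 ≤ b)
    (hgrowth : ∀ t, |f t| ≤ a * |t| + b * |t| ^ q) (hr : 0 < r) {u : H} (hu : ‖u‖ = r) :
    r * (r * (1 / 2 - a * C ^ 2 - b * C ^ (q + 1) * r ^ (q - 1)) - ‖ξ‖) ≤
      semilinearEnergy f J ξ u := by
  refine le_trans (le_of_eq ?_) (hJ.sub_le_semilinearEnergy hf hq ha hb hgrowth hu.le)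
  rw [hu, Real.mul_rpow hJ.nonneg hr.le, Real.rpow_add_one' hJ.nonneg (by positivity),
    Real.rpow_sub_one hr.ne']
  field_simp
  ring

theorem rpow_mul_potential_le (hJ : IsSobolevEmbedding J q C) (hf : IsSubcritical f q)
    (hq : 0 < q) {μ : ℝ} (hAR : AmbrosettiRabinowitz f μ) (u : H) {s : ℝ} (hs : 1 ≤ s) :
    s ^ μ * potential f J u ≤ potential f J (s • u) := by
  unfold potential
  rw [← integral_const_mul]
  refine integral_mono_ae ((hJ.integrable_primitive hf hq u).const_mul _)
    (hJ.integrable_primitive hf hq (s • u)) ?_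
  filter_upwards [(map_smul J s u).symm ▸ Lp.coeFn_smul s (J u)] with x hx
  rw [hx, Pi.smul_apply, smul_eq_mul]
  exact hAR.rpow_mul_primitive_le hf.continuous _ hs

theorem potential_pos (hJ : IsSobolevEmbedding J q C) (hf : IsSubcritical f q) (hq : 0 < q)
    {μ : ℝ} (hμ : 0 < μ) (hAR : AmbrosettiRabinowitz f μ) {u : H} (hu : J u ≠ 0) :
    0 < potential f J u := by
  have hpos : ∀ t, t ≠ 0 → 0 < primitive f t := fun t ht => pos_of_mul_pos_right (hAR t ht).1 hμ.le
  have hnonneg : ∀ t, 0 ≤ primitive f t := fun t => by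
    rcases eq_or_ne t 0 with rfl | ht
    · rw [primitive_zero]
    · exact (hpos t ht).le
  refine (integral_nonneg fun x => hnonneg _).lt_of_ne' fun h0 => hu ?_
  have hae := (integral_eq_zero_iff_of_nonneg (fun x => hnonneg _)
    (hJ.integrable_primitive hf hq u)).1 h0
  refine (Lp.eq_zero_iff_ae_eq_zero).2 ?_
  filter_upwards [hae] with x hx
  by_contra hne
  exact (hpos _ hne).ne' hx

/-- Along a ray the potential grows like `s ^ μ`, faster than the quadratic part. -/
theorem exists_semilinearEnergy_nonpos (hJ : IsSobolevEmbedding J q C) (hf : IsSubcritical f q)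
    (hq : 0 < q) {μ : ℝ} (hμ : 2 < μ) (hAR : AmbrosettiRabinowitz f μ) {u : H} (hu : J u ≠ 0)
    (r : ℝ) : ∃ e : H, r < ‖e‖ ∧ semilinearEnergy f J ξ e ≤ 0 := by
  have hpot := hJ.potential_pos hf hq (by linarith) hAR hu
  have hnorm : 0 < ‖u‖ := norm_pos_iff.2 fun h0 => hu (by rw [h0, map_zero])
  have hlim : Tendsto (fun s : ℝ => s ^ (μ - 2) * potential f J u) atTop atTop :=
    (tendsto_rpow_atTop (by linarith)).atTop_mul_const hpot
  obtain ⟨s, hs, hlarge, hsr⟩ := ((eventually_ge_atTop (1 : ℝ)).and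
    ((hlim.eventually_ge_atTop (‖u‖ ^ 2 / 2 + |inner ℝ ξ u|)).and
      (eventually_gt_atTop (r / ‖u‖)))).exists
  have hs0 : 0 < s := one_pos.trans_le hs
  refine ⟨s • u, ?_, ?_⟩
  · rwa [norm_smul, Real.norm_of_nonneg hs0.le, ← div_lt_iff₀ hnorm]
  · have hsq : s ^ μ = s ^ 2 * s ^ (μ - 2) := by
      rw [← Real.rpow_natCast, ← Real.rpow_add hs0]
      congr 1
      push_cast
      ring
    have hgrow : s ^ 2 * (‖u‖ ^ 2 / 2 + |inner ℝ ξ u|) ≤ potential f J (s • u) := by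
      refine le_trans ?_ (hJ.rpow_mul_potential_le hf hq hAR u hs)
      rw [hsq, mul_assoc]
      gcongr
    have hlinear : -(s * inner ℝ ξ u) ≤ s ^ 2 * |inner ℝ ξ u| := by
      rw [← mul_neg]
      exact (mul_le_mul_of_nonneg_left (neg_le_abs _) hs0.le).trans
        (mul_le_mul_of_nonneg_right (le_self_pow₀ hs two_ne_zero) (abs_nonneg _))
    rw [semilinearEnergy, norm_smul, Real.norm_of_nonneg hs0.le, inner_smul_right]
    linarith

variable [CompleteSpace H]

theorem hasGradientAt_semilinearEnergy (hJ : IsSobolevEmbedding J q C) (hf : IsSubcritical f q)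
    (hq : 0 < q) (u : H) :
    HasGradientAt (semilinearEnergy f J ξ) (u - ∇ (potential f J) u - ξ) u := by
  have h := ((hasGradientAt_half_norm_sq u).hasFDerivAt.sub
    (hJ.hasGradientAt_potential hf hq u).hasFDerivAt).sub (hasGradientAt_inner_left ξ u).hasFDerivAt
  rwa [← map_sub, ← map_sub] at h

theorem gradient_semilinearEnergy (hJ : IsSobolevEmbedding J q C) (hf : IsSubcritical f q)
    (hq : 0 < q) (u : H) :
    ∇ (semilinearEnergy f J ξ) u = u - ∇ (potential f J) u - ξ :=
  (hJ.hasGradientAt_semilinearEnergy hf hq u).gradient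

theorem contDiff_semilinearEnergy (hJ : IsSobolevEmbedding J q C) (hf : IsSubcritical f q)
    (hq : 0 < q) : ContDiff ℝ 1 (semilinearEnergy f J ξ) :=
  contDiff_one_of_hasGradientAt (hJ.hasGradientAt_semilinearEnergy hf hq)
    ((continuous_id.sub (hJ.continuous_gradient_potential hf hq)).sub continuous_const)

theorem mul_potential_le_inner_gradient (hJ : IsSobolevEmbedding J q C) (hf : IsSubcritical f q)
    (hq : 0 < q) {μ : ℝ} (hAR : AmbrosettiRabinowitz f μ) (u : H) :
    μ * potential f J u ≤ inner ℝ (∇ (potential f J) u) u := by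
  rw [hJ.inner_gradient_potential hf hq, potential, ← integral_const_mul]
  refine integral_mono ((hJ.integrable_primitive hf hq u).const_mul μ)
    (hJ.integrable_nemytskii_mul hf hq u u) fun x => ?_
  rcases eq_or_ne (J u x) 0 with h0 | h0
  · simp [h0, primitive_zero]
  · exact (hAR _ h0).2.trans_eq (mul_comm _ _)

/-- The combination `μ I(u) - ⟨∇I(u), u⟩` eliminates the nonlinear term. -/
theorem mul_norm_sq_le (hJ : IsSobolevEmbedding J q C) (hf : IsSubcritical f q)
    (hq : 0 < q) {μ : ℝ} (hμ : 1 ≤ μ) (hAR : AmbrosettiRabinowitz f μ) (u : H) :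
    (μ / 2 - 1) * ‖u‖ ^ 2 ≤ (‖∇ (semilinearEnergy f J ξ) u‖ + (μ - 1) * ‖ξ‖) * ‖u‖ +
      μ * semilinearEnergy f J ξ u := by
  have hgrad : inner ℝ (∇ (semilinearEnergy f J ξ) u) u =
      ‖u‖ ^ 2 - inner ℝ (∇ (potential f J) u) u - inner ℝ ξ u := by
    rw [hJ.gradient_semilinearEnergy hf hq, inner_sub_left, inner_sub_left,
      real_inner_self_eq_norm_sq]
  have henergy : μ * semilinearEnergy f J ξ u =
      μ / 2 * ‖u‖ ^ 2 - μ * potential f J u - μ * inner ℝ ξ u := by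
    unfold semilinearEnergy
    ring
  have hcs := neg_le_of_abs_le (abs_real_inner_le_norm (∇ (semilinearEnergy f J ξ) u) u)
  have hξ := mul_le_mul_of_nonneg_left (real_inner_le_norm ξ u) (sub_nonneg.2 hμ)
  linarith [hJ.mul_potential_le_inner_gradient hf hq hAR u]

end IsSobolevEmbedding

theorem le_of_mul_sq_le {θ D B x : ℝ} (hθ : 0 < θ) (hD : 0 ≤ D) (hB : 0 ≤ B)
    (h : θ * x ^ 2 ≤ D * x + B) : x ≤ (D + B) / θ + 1 := by
  by_contra! hlt
  have hx : 1 < x := (le_add_of_nonneg_left (by positivity)).trans_lt hlt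
  have hlarge : D + B < x * θ := (div_lt_iff₀ hθ).1 (by linarith)
  nlinarith

namespace IsSobolevEmbedding

variable [CompleteSpace H]

theorem exists_norm_le_of_palaisSmale (hJ : IsSobolevEmbedding J q C) (hf : IsSubcritical f q)
    (hq : 0 < q) {μ : ℝ} (hμ : 2 < μ) (hAR : AmbrosettiRabinowitz f μ) {u : ℕ → H} {B : ℝ}
    (hB : ∀ k, |semilinearEnergy f J ξ (u k)| ≤ B)
    (hgrad : Tendsto (fun k => ∇ (semilinearEnergy f J ξ) (u k)) atTop (𝓝 0)) :
    ∃ R, ∀ k, ‖u k‖ ≤ R := by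
  obtain ⟨G, hG⟩ := hgrad.norm.bddAbove_range
  have hGk : ∀ k, ‖∇ (semilinearEnergy f J ξ) (u k)‖ ≤ G := fun k => hG ⟨k, rfl⟩
  have hG0 : 0 ≤ G := (norm_nonneg _).trans (hGk 0)
  have hB0 : 0 ≤ B := (abs_nonneg _).trans (hB 0)
  have hμ1 : 0 ≤ μ - 1 := by linarith
  refine ⟨((G + (μ - 1) * ‖ξ‖) + μ * B) / (μ / 2 - 1) + 1, fun k =>
    le_of_mul_sq_le (by linarith) (by positivity) (by positivity) ?_⟩
  refine (hJ.mul_norm_sq_le (ξ := ξ) hf hq (by linarith) hAR (u k)).trans ?_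
  gcongr
  · exact hGk k
  · exact (le_abs_self _).trans (hB k)

theorem palaisSmale_semilinearEnergy (hJ : IsSobolevEmbedding J q C) (hf : IsSubcritical f q)
    (hq : 0 < q) (hcompact : IsCompactOperator J) {μ : ℝ} (hμ : 2 < μ)
    (hAR : AmbrosettiRabinowitz f μ) : PalaisSmale (semilinearEnergy f J ξ) := by
  intro u B hB hgrad
  obtain ⟨R, hR⟩ := hJ.exists_norm_le_of_palaisSmale hf hq hμ hAR hB hgrad
  obtain ⟨a, φ, hφ, ha⟩ := hJ.exists_subseq_tendsto_gradient_potential hf hq hcompact hR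
  refine ⟨0 + a + ξ, φ, hφ,
    (((hgrad.comp hφ.tendsto_atTop).add ha).add_const ξ).congr fun k => ?_⟩
  simp only [Function.comp_apply, hJ.gradient_semilinearEnergy hf hq]
  abel

theorem exists_two_critical_points (hJ : IsSobolevEmbedding J q C) (hf : IsSubcritical f q)
    (hq : 0 < q) (hcompact : IsCompactOperator J) {μ : ℝ} (hμ : 2 < μ)
    (hAR : AmbrosettiRabinowitz f μ) {a b r : ℝ} (ha : 0 ≤ a) (hb : 0 ≤ b)
    (hgrowth : ∀ t, |f t| ≤ a * |t| + b * |t| ^ q) (hr : 0 < r)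
    (hξ : ‖ξ‖ < r * (1 / 2 - a * C ^ 2 - b * C ^ (q + 1) * r ^ (q - 1)))
    {u₀ : H} (hu₀ : J u₀ ≠ 0) :
    ∃ u₁ u₂ : H, (∇ (semilinearEnergy f J ξ) u₁ = 0 ∧ 0 < semilinearEnergy f J ξ u₁ ∧
        IsGLB (pathMax (semilinearEnergy f J ξ) '' admissiblePaths (semilinearEnergy f J ξ) r)
          (semilinearEnergy f J ξ u₁)) ∧
      ∇ (semilinearEnergy f J ξ) u₂ = 0 ∧ ‖u₂‖ < r ∧
        ∀ w, ‖w‖ ≤ r → semilinearEnergy f J ξ u₂ ≤ semilinearEnergy f J ξ w := by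
  have hPS := hJ.palaisSmale_semilinearEnergy (ξ := ξ) hf hq hcompact hμ hAR
  have hI := hJ.contDiff_semilinearEnergy (ξ := ξ) hf hq
  have hβ := mul_pos hr (sub_pos.2 hξ)
  have hsphere := fun u : H =>
    hJ.le_semilinearEnergy_of_norm_eq (ξ := ξ) hf hq ha hb hgrowth hr (u := u)
  obtain ⟨e, he, hIe⟩ := hJ.exists_semilinearEnergy_nonpos (ξ := ξ) hf hq hμ hAR hu₀ r
  obtain ⟨u₁, hcrit₁, hpos, hglb⟩ :=
    hPS.mountain_pass hI semilinearEnergy_zero.le hr.le hβ hsphere he hIe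
  obtain ⟨u₂, hlt, hcrit₂, hmin⟩ := hPS.exists_ball_minimizer hI
    (hJ.bddBelow_semilinearEnergy hf hq ha hb hgrowth r)
    (Metric.mem_closedBall_self hr.le)
    fun w hw => semilinearEnergy_zero.trans_lt (hβ.trans_le (hsphere w hw))
  exact ⟨u₁, u₂, ⟨hcrit₁, hβ.trans_le hpos, hglb⟩, hcrit₂, hlt, hmin⟩

end IsSobolevEmbedding

end SemilinearEnergy

section EnergySpace

variable {n : ℕ} {α : ℝ} {V : E n → ℝ}

/-- The square root of the Gagliardo denominator `‖x - y‖ ^ (n + 2α)`. -/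
noncomputable def halfKernel {n : ℕ} (α : ℝ) (z : E n × E n) : ℝ :=
  ‖z.1 - z.2‖ ^ (((n : ℝ) + 2 * α) / 2)

theorem halfKernel_sq (z : E n × E n) :
    halfKernel α z ^ 2 = ‖z.1 - z.2‖ ^ ((n : ℝ) + 2 * α) := by
  rw [halfKernel, ← Real.rpow_mul_natCast (norm_nonneg _)]
  congr 1
  push_cast
  ring

theorem measurable_halfKernel : Measurable (halfKernel α : E n × E n → ℝ) := by
  unfold halfKernel
  fun_prop

/-- The fractional difference quotient of `u`, whose square is the Gagliardo integrand. It is `0` on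
the diagonal, where the kernel vanishes. -/
noncomputable def diffQuotient {n : ℕ} (α : ℝ) : (E n → ℝ) →ₗ[ℝ] (E n × E n → ℝ) where
  toFun u z := (u z.1 - u z.2) / halfKernel α z
  map_add' u w := by
    ext z
    simp only [Pi.add_apply]
    ring
  map_smul' c u := by
    ext z
    simp only [Pi.smul_apply, smul_eq_mul, RingHom.id_apply]
    ring

theorem diffQuotient_apply (u : E n → ℝ) (z : E n × E n) :
    diffQuotient α u z = (u z.1 - u z.2) / halfKernel α z := rfl

theorem diffQuotient_mul (u w : E n → ℝ) (z : E n × E n) :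
    diffQuotient α u z * diffQuotient α w z =
      (u z.1 - u z.2) * (w z.1 - w z.2) / ‖z.1 - z.2‖ ^ ((n : ℝ) + 2 * α) := by
  rw [diffQuotient_apply, diffQuotient_apply, div_mul_div_comm, ← halfKernel_sq, sq]

theorem diffQuotient_sq (u : E n → ℝ) (z : E n × E n) :
    diffQuotient α u z ^ 2 = (u z.1 - u z.2) ^ 2 / ‖z.1 - z.2‖ ^ ((n : ℝ) + 2 * α) := by
  rw [sq, diffQuotient_mul, sq]

theorem diffQuotient_congr {u w : E n → ℝ} (h : u =ᵐ[volume] w) :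
    diffQuotient α u =ᵐ[volume.prod volume] diffQuotient α w := by
  filter_upwards [Measure.quasiMeasurePreserving_fst.ae_eq_comp h,
    Measure.quasiMeasurePreserving_snd.ae_eq_comp h] with z hfst hsnd
  simp only [Function.comp_apply] at hfst hsnd
  rw [diffQuotient_apply, diffQuotient_apply, hfst, hsnd]

theorem aestronglyMeasurable_diffQuotient {u : E n → ℝ} (hu : AEStronglyMeasurable u volume) :
    AEStronglyMeasurable (diffQuotient α u) (volume.prod volume) :=
  ((hu.comp_fst.sub hu.comp_snd).aemeasurable.div
    measurable_halfKernel.aemeasurable).aestronglyMeasurable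

theorem innerV_eq (u w : E n → ℝ) : innerV α V u w =
    (∫ z, diffQuotient α u z * diffQuotient α w z ∂(volume.prod volume)) +
      ∫ x, V x * u x * w x := by
  simp_rw [innerV, diffQuotient_mul]

theorem innerV_congr {u u' w w' : E n → ℝ} (hu : u =ᵐ[volume] u') (hw : w =ᵐ[volume] w') :
    innerV α V u w = innerV α V u' w' := by
  rw [innerV_eq, innerV_eq]
  congr 1
  · refine integral_congr_ae ?_
    filter_upwards [diffQuotient_congr (α := α) hu, diffQuotient_congr (α := α) hw] with z h h'
    rw [h, h']
  · refine integral_congr_ae ?_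
    filter_upwards [hu, hw] with x h h'
    rw [h, h']

theorem normV_congr {u u' : E n → ℝ} (hu : u =ᵐ[volume] u') : normV α V u = normV α V u' := by
  rw [normV, normV, innerV_congr hu hu]

/-- A continuous potential bounded below by a positive constant. -/
structure UniformlyPositive (V : E n → ℝ) : Prop where
  continuous : Continuous V
  exists_pos_le : ∃ c > 0, ∀ x, c ≤ V x

namespace UniformlyPositive

theorem pos (hV : UniformlyPositive V) (x : E n) : 0 < V x := by
  obtain ⟨c, hc, hcV⟩ := hV.exists_pos_le
  exact hc.trans_le (hcV x)

theorem memLp_inv_sqrt (hV : UniformlyPositive V) :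
    MemLp (fun x => (√(V x))⁻¹) ∞ volume := by
  obtain ⟨c, hc, hcV⟩ := hV.exists_pos_le
  refine memLp_top_of_bound
    (hV.continuous.sqrt.inv₀ fun x => (Real.sqrt_pos.2 (hV.pos x)).ne').aestronglyMeasurable
    (√c)⁻¹ (Eventually.of_forall fun x => ?_)
  rw [Real.norm_of_nonneg (by positivity)]
  have := Real.sqrt_pos.2 hc
  gcongr
  exact hcV x

/-- Division by `√V` on `L²`. -/
@[irreducible] noncomputable def divSqrt (hV : UniformlyPositive V) :
    Lp ℝ 2 (volume : Measure (E n)) →L[ℝ] Lp ℝ 2 (volume : Measure (E n)) :=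
  (ContinuousLinearMap.mul ℝ ℝ).holderL volume ∞ 2 2 (hV.memLp_inv_sqrt.toLp _)

theorem coeFn_divSqrt (hV : UniformlyPositive V) (v : Lp ℝ 2 (volume : Measure (E n))) :
    hV.divSqrt v =ᵐ[volume] fun x => v x / √(V x) := by
  filter_upwards [(ContinuousLinearMap.mul ℝ ℝ).coeFn_holder (r := 2)
    (hV.memLp_inv_sqrt.toLp _) v, hV.memLp_inv_sqrt.coeFn_toLp] with x hx hinv
  rw [divSqrt]
  refine hx.trans ?_
  rw [hinv, ContinuousLinearMap.mul_apply', inv_mul_eq_div]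

end UniformlyPositive

/-- `L²(ℝⁿ × ℝⁿ) × L²(ℝⁿ)` with its Hilbert norm, in which `energySpace` lies. -/
abbrev EnergyProd (n : ℕ) : Type :=
  WithLp 2 (Lp ℝ 2 ((volume : Measure (E n)).prod (volume : Measure (E n))) ×
    Lp ℝ 2 (volume : Measure (E n)))

/-- `H^α_V` with almost everywhere equal functions identified, as a subspace of a Hilbert space: `u`
is represented by the pair of its difference quotient and `√V u`. -/
noncomputable def energySpace (α : ℝ) (hV : UniformlyPositive V) :
    Submodule ℝ (EnergyProd n) where
  carrier := {p | p.fst =ᵐ[volume.prod volume] diffQuotient α (hV.divSqrt p.snd)}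
  add_mem' {p q} hp hq := by
    rw [Set.mem_ofPred_eq] at hp hq ⊢
    refine (Lp.coeFn_add p.fst q.fst).trans ((EventuallyEq.add hp hq).trans ?_)
    rw [← map_add, WithLp.add_snd, map_add hV.divSqrt]
    exact diffQuotient_congr (Lp.coeFn_add _ _).symm
  zero_mem' := by
    refine (Lp.coeFn_zero _ _ _).trans ?_
    rw [WithLp.zero_snd, map_zero hV.divSqrt, ← map_zero (diffQuotient α)]
    exact diffQuotient_congr (Lp.coeFn_zero _ _ _).symm
  smul_mem' c p hp := by
    rw [Set.mem_ofPred_eq] at hp ⊢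
    refine (Lp.coeFn_smul c p.fst).trans ((EventuallyEq.const_smul hp c).trans ?_)
    rw [← map_smul, WithLp.smul_snd, map_smul hV.divSqrt]
    exact diffQuotient_congr (Lp.coeFn_smul _ _).symm

variable {hV : UniformlyPositive V}

theorem isClosed_energySpace : IsClosed (energySpace α hV : Set (EnergyProd n)) := by
  refine isClosed_of_closure_subset fun p hp => ?_
  obtain ⟨s, hs, hlim⟩ := mem_closure_iff_seq_limit.1 hp
  have hfst : Tendsto (fun k => (s k).fst) atTop (𝓝 p.fst) :=
    ((WithLp.continuous_fst _ _ _).tendsto p).comp hlim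
  have hsnd : Tendsto (fun k => hV.divSqrt (s k).snd) atTop (𝓝 (hV.divSqrt p.snd)) :=
    ((hV.divSqrt.continuous.comp (WithLp.continuous_snd _ _ _)).tendsto p).comp hlim
  obtain ⟨φ, hφ, hfst_ae⟩ := (tendstoInMeasure_of_tendsto_Lp hfst).exists_seq_tendsto_ae
  obtain ⟨ψ, hψ, hsnd_ae⟩ :=
    (tendstoInMeasure_of_tendsto_Lp (hsnd.comp hφ.tendsto_atTop)).exists_seq_tendsto_ae
  have hmem : ∀ᵐ z ∂(volume : Measure (E n)).prod volume, ∀ k,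
      (s k).fst z = diffQuotient α (hV.divSqrt (s k).snd) z := ae_all_iff.2 hs
  change p.fst =ᵐ[_] _
  filter_upwards [hfst_ae, hmem, Measure.quasiMeasurePreserving_fst.ae hsnd_ae,
    Measure.quasiMeasurePreserving_snd.ae hsnd_ae] with z hz hquot hz₁ hz₂
  refine tendsto_nhds_unique (hz.comp hψ.tendsto_atTop) ?_
  simp only [Function.comp_def, hquot] at hz₁ hz₂ ⊢
  exact (hz₁.sub hz₂).div_const _

instance : CompleteSpace (energySpace α hV) := isClosed_energySpace.completeSpace_coe

/-- The embedding of the energy space into `L²`, recovering `u` from `√V u`. -/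
noncomputable def toL2 (α : ℝ) (hV : UniformlyPositive V) :
    energySpace α hV →L[ℝ] Lp ℝ 2 (volume : Measure (E n)) :=
  hV.divSqrt ∘L WithLp.sndL 2 ℝ _ _ ∘L (energySpace α hV).subtypeL

theorem fst_ae_eq (p : energySpace α hV) :
    p.1.fst =ᵐ[volume.prod volume] diffQuotient α (toL2 α hV p) := p.2

theorem snd_ae_eq (p : energySpace α hV) :
    p.1.snd =ᵐ[volume] fun x => √(V x) * toL2 α hV p x := by
  filter_upwards [hV.coeFn_divSqrt p.1.snd] with x hx
  rw [show toL2 α hV p x = _ from hx, mul_div_cancel₀ _ (Real.sqrt_pos.2 (hV.pos x)).ne']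

theorem memHV_toL2 (p : energySpace α hV) : MemHV α V (toL2 α hV p) := by
  refine ⟨⟨Lp.memLp _, ?_⟩, ?_⟩
  · simp_rw [← diffQuotient_sq]
    refine (Lp.memLp p.1.fst).integrable_sq.congr ?_
    filter_upwards [fst_ae_eq p] with z hz
    rw [hz]
  · refine (Lp.memLp p.1.snd).integrable_sq.congr ?_
    filter_upwards [snd_ae_eq p] with x hx
    rw [hx, mul_pow, Real.sq_sqrt (hV.pos x).le]

theorem inner_eq_innerV (p q : energySpace α hV) :
    inner ℝ p q = innerV α V (toL2 α hV p) (toL2 α hV q) := by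
  rw [Submodule.coe_inner, WithLp.prod_inner_apply, innerV_eq]
  change inner ℝ p.1.fst q.1.fst + inner ℝ p.1.snd q.1.snd = _
  rw [L2.inner_def, L2.inner_def]
  congr 1
  · refine integral_congr_ae ?_
    filter_upwards [fst_ae_eq p, fst_ae_eq q] with z hp hq
    rw [hp, hq, RCLike.inner_apply, conj_trivial, mul_comm]
  · refine integral_congr_ae ?_
    filter_upwards [snd_ae_eq p, snd_ae_eq q] with x hp hq
    simp only [hp, hq, RCLike.inner_apply, conj_trivial]
    linear_combination (toL2 α hV p x * toL2 α hV q x) * Real.mul_self_sqrt (hV.pos x).le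

theorem normV_toL2 (p : energySpace α hV) : normV α V (toL2 α hV p) = ‖p‖ := by
  rw [normV, ← inner_eq_innerV, real_inner_self_eq_norm_sq, Real.sqrt_sq (norm_nonneg _)]

theorem norm_sq_eq (p : energySpace α hV) :
    ‖p‖ ^ 2 = (∫ z, diffQuotient α (toL2 α hV p) z ^ 2 ∂(volume.prod volume)) +
      ∫ x, V x * toL2 α hV p x ^ 2 := by
  rw [← real_inner_self_eq_norm_sq, inner_eq_innerV, innerV_eq]
  simp_rw [sq, mul_assoc]

theorem integrable_sq_diffQuotient {u : E n → ℝ} (hu : MemH α u) :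
    Integrable (fun z => diffQuotient α u z ^ 2) (volume.prod volume) := by
  simpa only [diffQuotient_sq] using hu.2

theorem exists_toL2_ae_eq (hV : UniformlyPositive V) {u : E n → ℝ} (hu : MemHV α V u) :
    ∃ p, toL2 α hV p =ᵐ[volume] u := by
  have hmeas := hu.1.1.aestronglyMeasurable
  have hfst : MemLp (diffQuotient α u) 2 (volume.prod volume) :=
    (memLp_two_iff_integrable_sq (aestronglyMeasurable_diffQuotient hmeas)).2
      (integrable_sq_diffQuotient hu.1)
  have hsnd : MemLp (fun x => √(V x) * u x) 2 volume := by
    have hmul : AEStronglyMeasurable (fun x => √(V x) * u x) volume :=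
      hV.continuous.sqrt.aestronglyMeasurable.mul hmeas
    rw [memLp_two_iff_integrable_sq hmul]
    simpa only [mul_pow, Real.sq_sqrt (hV.pos _).le] using hu.2
  have hdiv : hV.divSqrt (hsnd.toLp _) =ᵐ[volume] u := by
    filter_upwards [hV.coeFn_divSqrt (hsnd.toLp _), hsnd.coeFn_toLp] with x hx hx'
    rw [hx, hx', mul_div_cancel_left₀ _ (Real.sqrt_pos.2 (hV.pos x)).ne']
  exact ⟨⟨WithLp.toLp 2 (hfst.toLp _, hsnd.toLp _),
    hfst.coeFn_toLp.trans (diffQuotient_congr hdiv).symm⟩, hdiv⟩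

end EnergySpace

section Compactness

theorem isCompactOperator_of_approx {𝕜 H F : Type*} [NontriviallyNormedField 𝕜]
    [NormedAddCommGroup H] [NormedSpace 𝕜 H] [NormedAddCommGroup F] [NormedSpace 𝕜 F]
    [CompleteSpace F] {J : H →L[𝕜] F}
    (h : ∀ ε > 0, ∃ T : F →L[𝕜] F, IsCompactOperator T ∧ ∀ p, ‖J p - T (J p)‖ ≤ ε * ‖p‖) :
    IsCompactOperator J := by
  refine isClosed_setOfPred_isCompactOperator.closure_subset
    ((Metric.mem_closure_iff (α := H →L[𝕜] F)).2 fun ε hε => ?_)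
  obtain ⟨T, hT, hle⟩ := h (ε / 2) (half_pos hε)
  refine ⟨T.comp J, hT.comp_clm J, ?_⟩
  rw [dist_eq_norm]
  exact (ContinuousLinearMap.opNorm_le_bound _ (half_pos hε).le hle).trans_lt (half_lt_self hε)

theorem norm_sq_eq_integral {X : Type*} [MeasurableSpace X] {ν : Measure X} (u : Lp ℝ 2 ν) :
    ‖u‖ ^ 2 = ∫ x, u x ^ 2 ∂ν := by
  rw [← real_inner_self_eq_norm_sq, L2.inner_def]
  simp only [RCLike.inner_apply, conj_trivial, sq]

variable {n : ℕ} {α s : ℝ} {V : E n → ℝ} {K : Set (E n)}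

/-- The Gagliardo density `∫ (u x - u y)² / ‖x - y‖ ^ (n + 2α) dy` at the point `x`. -/
noncomputable def density {n : ℕ} (α : ℝ) (u : E n → ℝ) (x : E n) : ℝ :=
  ∫ y, diffQuotient α u (x, y) ^ 2

theorem density_nonneg (u : E n → ℝ) (x : E n) : 0 ≤ density α u x :=
  integral_nonneg fun _ => sq_nonneg _

theorem integral_density {u : E n → ℝ} (hu : MemH α u) :
    ∫ x, density α u x = ∫ z, diffQuotient α u z ^ 2 ∂(volume.prod volume) :=
  (integral_prod _ (integrable_sq_diffQuotient hu)).symm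

theorem sq_sub_le (hα : 0 < α) (u : E n → ℝ) {x y : E n} {d : ℝ} (hd : ‖x - y‖ ≤ d) :
    (u x - u y) ^ 2 ≤ d ^ ((n : ℝ) + 2 * α) * diffQuotient α u (x, y) ^ 2 := by
  rcases eq_or_ne x y with rfl | hxy
  · simp [diffQuotient_apply]
  · have hpos : 0 < ‖x - y‖ := norm_pos_iff.2 (sub_ne_zero.2 hxy)
    rw [diffQuotient_sq, mul_div_assoc', le_div_iff₀ (by positivity), mul_comm]
    gcongr

/-- The constant of the fractional Poincaré inequality on balls of radius `s`. -/
noncomputable def poincareConst (n : ℕ) (α s : ℝ) : ℝ :=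
  (volume.real (Metric.ball (0 : E n) s))⁻¹ * (2 * s) ^ ((n : ℝ) + 2 * α)

theorem poincareConst_nonneg (hs : 0 < s) : 0 ≤ poincareConst n α s := by
  unfold poincareConst
  positivity

theorem volume_real_ball (x : E n) (hs : 0 < s) :
    volume.real (Metric.ball x s) = s ^ (n : ℝ) * volume.real (Metric.ball (0 : E n) 1) := by
  rw [Measure.real, Measure.addHaar_ball_of_pos _ _ hs, ENNReal.toReal_mul,
    ENNReal.toReal_ofReal (by positivity), finrank_euclideanSpace_fin, Measure.real,
    Real.rpow_natCast]

theorem poincareConst_eq (hs : 0 < s) :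
    poincareConst n α s = poincareConst n α 1 * s ^ (2 * α) := by
  rw [poincareConst, poincareConst, volume_real_ball 0 hs, mul_one, Real.mul_rpow two_pos.le hs.le,
    Real.rpow_add hs]
  field_simp

theorem tendsto_poincareConst (hα : 0 < α) :
    Tendsto (poincareConst n α) (𝓝[>] 0) (𝓝 0) := by
  have hpow : Tendsto (fun s : ℝ => s ^ (2 * α)) (𝓝[>] 0) (𝓝 0) := by
    have := (Real.continuousAt_rpow_const 0 (2 * α) (Or.inr (by positivity))).tendsto
    rw [Real.zero_rpow (by positivity)] at this
    exact this.mono_left nhdsWithin_le_nhds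
  have hlim := hpow.const_mul (poincareConst n α 1)
  rw [mul_zero] at hlim
  refine hlim.congr' ?_
  filter_upwards [self_mem_nhdsWithin] with s (hs : 0 < s)
  rw [poincareConst_eq hs]

theorem sq_sub_average_le (hα : 0 < α) {u : E n → ℝ} (hu : MemLp u 2 volume) {x c : E n}
    (hs : 0 < s) (hx : x ∈ Metric.ball c s)
    (hint : Integrable (fun y => diffQuotient α u (x, y) ^ 2) volume) :
    (u x - ⨍ y in Metric.ball c s, u y) ^ 2 ≤ poincareConst n α s * density α u x := by
  set B := Metric.ball c s
  have hB0 : volume B ≠ 0 := (Metric.measure_ball_pos _ _ hs).ne'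
  have hBtop : volume B ≠ ∞ := measure_ball_lt_top.ne
  have : IsFiniteMeasure ((volume : Measure (E n)).restrict B) :=
    ⟨by simpa using measure_ball_lt_top⟩
  have hdiff : MemLp (fun y => u x - u y) 2 (volume.restrict B) :=
    (memLp_const (u x)).sub (hu.restrict B)
  have haverage : u x - ⨍ y in B, u y = ⨍ y in B, (u x - u y) := by
    rw [setAverage_eq _ fun y => u x - u y, integral_sub (integrable_const _)
      ((hu.restrict B).integrable one_le_two), smul_sub, ← setAverage_eq, ← setAverage_eq,
      setAverage_const hB0 hBtop]
  have hjensen : (⨍ y in B, (u x - u y)) ^ 2 ≤ ⨍ y in B, (u x - u y) ^ 2 :=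
    even_two.convexOn_pow.map_set_average_le (continuous_pow 2).continuousOn isClosed_univ hB0 hBtop
      (by simp) (hdiff.integrable one_le_two) hdiff.integrable_sq
  have hball : ∫ y in B, (u x - u y) ^ 2 ≤ (2 * s) ^ ((n : ℝ) + 2 * α) * density α u x :=
    calc ∫ y in B, (u x - u y) ^ 2
        ≤ ∫ y in B, (2 * s) ^ ((n : ℝ) + 2 * α) * diffQuotient α u (x, y) ^ 2 := by
          refine setIntegral_mono_on hdiff.integrable_sq (hint.const_mul _).integrableOn
            measurableSet_ball fun y hy => sq_sub_le hα u ?_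
          rw [← dist_eq_norm]
          linarith [dist_triangle_right x y c, Metric.mem_ball.1 hx, Metric.mem_ball.1 hy]
      _ ≤ ∫ y, (2 * s) ^ ((n : ℝ) + 2 * α) * diffQuotient α u (x, y) ^ 2 :=
          setIntegral_le_integral (hint.const_mul _) (Eventually.of_forall fun y => by positivity)
      _ = _ := by rw [integral_const_mul, density]
  rw [haverage]
  refine hjensen.trans ?_
  rw [setAverage_eq, smul_eq_mul, poincareConst, mul_assoc, Measure.addHaar_real_ball_center]
  gcongr

/-- Finitely many disjoint measurable sets covering `K`, each inside a ball of radius `s`. -/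
structure SmallPieces (K : Set (E n)) (s : ℝ) where
  card : ℕ
  center : Fin card → E n
  piece : Fin card → Set (E n)
  measurableSet : ∀ i, MeasurableSet (piece i)
  subset_ball : ∀ i, piece i ⊆ Metric.ball (center i) s
  pairwise_disjoint : Pairwise (Function.onFun Disjoint piece)
  subset_iUnion : K ⊆ ⋃ i, piece i

theorem nonempty_smallPieces (hK : IsCompact K) (hs : 0 < s) : Nonempty (SmallPieces K s) := by
  obtain ⟨t, -, ht, hcover⟩ := hK.finite_cover_balls hs
  obtain ⟨N, c, rfl⟩ : ∃ (N : ℕ) (c : Fin N → E n), Set.range c = t := by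
    obtain ⟨N, e, -, hc⟩ := ht.fin_param
    exact ⟨N, e, hc⟩
  exact ⟨{
    card := N
    center := c
    piece := disjointed fun i => Metric.ball (c i) s
    measurableSet := fun i => disjointedRec (p := MeasurableSet)
      (fun _ _ ht => ht.diff measurableSet_ball) measurableSet_ball
    subset_ball := disjointed_subset _
    pairwise_disjoint := disjoint_disjointed _
    subset_iUnion := by
      rw [iUnion_disjointed]
      simpa using hcover }⟩

namespace SmallPieces

theorem volume_piece_ne_top (P : SmallPieces K s) (i : Fin P.card) : volume (P.piece i) ≠ ∞ :=
  ((measure_mono (P.subset_ball i)).trans_lt measure_ball_lt_top).ne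

/-- The operator replacing `u` on each piece by its average over the ball of that piece, and by `0`
off the pieces. -/
@[irreducible] noncomputable def averaging (P : SmallPieces K s) :
    Lp ℝ 2 (volume : Measure (E n)) →L[ℝ] Lp ℝ 2 (volume : Measure (E n)) :=
  ∑ i, (innerSL ℝ (indicatorConstLp 2 (measurableSet_ball (x := P.center i) (ε := s))
      measure_ball_lt_top.ne (volume.real (Metric.ball (P.center i) s))⁻¹)).smulRight
    (indicatorConstLp 2 (P.measurableSet i) (P.volume_piece_ne_top i) 1)

theorem isCompactOperator_averaging (P : SmallPieces K s) : IsCompactOperator P.averaging := by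
  unfold averaging
  change _ ∈ compactOperator (RingHom.id ℝ) _ _
  refine Submodule.sum_mem _ fun i _ => ?_
  exact (isCompactOperator_of_locallyCompactSpace_rng (ContinuousLinearMap.toSpanSingleton ℝ
    (indicatorConstLp 2 (P.measurableSet i) (P.volume_piece_ne_top i) (1 : ℝ)))).comp_clm
      (innerSL ℝ (indicatorConstLp 2 (measurableSet_ball (x := P.center i) (ε := s))
        measure_ball_lt_top.ne (volume.real (Metric.ball (P.center i) s))⁻¹))

theorem coeFn_averaging (P : SmallPieces K s) (u : Lp ℝ 2 (volume : Measure (E n))) :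
    P.averaging u =ᵐ[volume] fun x => ∑ i,
      (P.piece i).indicator (fun _ => ⨍ y in Metric.ball (P.center i) s, u y) x := by
  set c : Fin P.card → ℝ := fun i => ⨍ y in Metric.ball (P.center i) s, u y
  set χ := fun i => indicatorConstLp 2 (P.measurableSet i) (P.volume_piece_ne_top i) (1 : ℝ)
  have hsum : P.averaging u = ∑ i, c i • χ i := by
    simp only [averaging, sum_apply, ContinuousLinearMap.smulRight_apply,
      innerSL_apply_apply, L2.inner_indicatorConstLp_eq_inner_setIntegral, RCLike.inner_apply,
      conj_trivial, c, χ, setAverage_eq, smul_eq_mul, mul_comm]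
  rw [hsum]
  have hχ : ∀ᵐ x, ∀ i, (c i • χ i) x = (P.piece i).indicator (fun _ => c i) x :=
    ae_all_iff.2 fun i => by
      filter_upwards [Lp.coeFn_smul (c i) (χ i), indicatorConstLp_coeFn (p := 2)
        (hs := P.measurableSet i) (hμs := P.volume_piece_ne_top i) (c := (1 : ℝ))] with x hx h1
      rw [hx, Pi.smul_apply, h1, ← Set.indicator_const_smul_apply, smul_eq_mul, mul_one]
  filter_upwards [Lp.coeFn_finsetSum Finset.univ fun i => c i • χ i, hχ] with x hx hi
  rw [hx, Finset.sum_apply]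
  exact Finset.sum_congr rfl fun i _ => hi i

theorem sq_sub_averaging_le (hα : 0 < α) (hs : 0 < s) (P : SmallPieces K s) {M : ℝ} (hM : 0 < M)
    (hV : ∀ x, 0 ≤ V x) (htail : ∀ x ∉ K, M ≤ V x) (u : Lp ℝ 2 (volume : Measure (E n)))
    (hu : MemH α u) :
    ∀ᵐ x, (u - P.averaging u) x ^ 2 ≤
      poincareConst n α s * density α u x + M⁻¹ * (V x * u x ^ 2) := by
  filter_upwards [Lp.coeFn_sub u (P.averaging u), P.coeFn_averaging u,
    (integrable_sq_diffQuotient hu).prod_right_ae] with x hsub havg hint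
  rw [hsub, Pi.sub_apply, havg]
  by_cases hx : ∃ i, x ∈ P.piece i
  · obtain ⟨i, hi⟩ := hx
    have hsum : ∑ j, (P.piece j).indicator (fun _ => ⨍ y in Metric.ball (P.center j) s, u y) x =
        ⨍ y in Metric.ball (P.center i) s, u y := by
      rw [Finset.sum_eq_single i, Set.indicator_of_mem hi]
      · exact fun j _ hj => Set.indicator_of_notMem
          (Set.disjoint_right.1 (P.pairwise_disjoint hj) hi) _
      · simp
    rw [hsum]
    have hVx := hV x
    exact (sq_sub_average_le hα (Lp.memLp u) hs (P.subset_ball i hi) hint).trans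
      (le_add_of_nonneg_right (by positivity))
  · have hMV : M ≤ V x := htail x fun hxK => hx (Set.mem_iUnion.1 (P.subset_iUnion hxK))
    rw [Finset.sum_eq_zero fun i _ => Set.indicator_of_notMem (not_exists.1 hx i) _, sub_zero,
      ← mul_assoc]
    refine le_add_of_nonneg_of_le (mul_nonneg (poincareConst_nonneg hs) (density_nonneg _ _)) ?_
    refine le_mul_of_one_le_left (sq_nonneg _) ?_
    rwa [inv_mul_eq_div, one_le_div hM]

theorem norm_sub_averaging_sq_le (hα : 0 < α) (hs : 0 < s) (P : SmallPieces K s) {M : ℝ}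
    (hM : 0 < M) (hV : UniformlyPositive V) (htail : ∀ x ∉ K, M ≤ V x) (p : energySpace α hV) :
    ‖toL2 α hV p - P.averaging (toL2 α hV p)‖ ^ 2 ≤ (poincareConst n α s + M⁻¹) * ‖p‖ ^ 2 := by
  set u := toL2 α hV p
  have hu : MemHV α V u := memHV_toL2 p
  have hκ := poincareConst_nonneg (n := n) (α := α) hs
  have hdensity : Integrable (fun x => poincareConst n α s * density α u x) volume :=
    (integrable_sq_diffQuotient hu.1).integral_prod_left.const_mul _
  have hpotential : Integrable (fun x => M⁻¹ * (V x * u x ^ 2)) volume := hu.2.const_mul _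
  have hG : 0 ≤ ∫ z, diffQuotient α u z ^ 2 ∂(volume.prod volume) :=
    integral_nonneg fun _ => sq_nonneg _
  have hP : 0 ≤ ∫ x, V x * u x ^ 2 :=
    integral_nonneg fun x => mul_nonneg (hV.pos x).le (sq_nonneg _)
  calc ‖u - P.averaging u‖ ^ 2 = ∫ x, (u - P.averaging u) x ^ 2 := norm_sq_eq_integral _
    _ ≤ ∫ x, (poincareConst n α s * density α u x + M⁻¹ * (V x * u x ^ 2)) :=
        integral_mono_ae (Lp.memLp _).integrable_sq (hdensity.add hpotential)
          (P.sq_sub_averaging_le hα hs hM (fun x => (hV.pos x).le) htail u hu.1)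
    _ = poincareConst n α s * (∫ z, diffQuotient α u z ^ 2 ∂(volume.prod volume)) +
          M⁻¹ * ∫ x, V x * u x ^ 2 := by
        rw [integral_add hdensity hpotential, integral_const_mul, integral_const_mul,
          integral_density hu.1]
    _ ≤ (poincareConst n α s + M⁻¹) * ((∫ z, diffQuotient α u z ^ 2 ∂(volume.prod volume)) +
          ∫ x, V x * u x ^ 2) := by
        rw [add_mul]
        gcongr
        · exact le_add_of_nonneg_right hP
        · exact le_add_of_nonneg_left hG
    _ = (poincareConst n α s + M⁻¹) * ‖p‖ ^ 2 := by rw [norm_sq_eq]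

end SmallPieces

theorem isCompactOperator_toL2 (hα : 0 < α) (hV : UniformlyPositive V)
    (hVinf : Tendsto V (cocompact (E n)) atTop) : IsCompactOperator (toL2 α hV) := by
  refine isCompactOperator_of_approx fun ε hε => ?_
  obtain ⟨K, hK, hKM⟩ := mem_cocompact.1 (hVinf.eventually_ge_atTop (2 / ε ^ 2))
  obtain ⟨s, hsκ, (hs : 0 < s)⟩ := (((tendsto_poincareConst (n := n) hα).eventually_le_const
    (show (0 : ℝ) < ε ^ 2 / 2 by positivity)).and self_mem_nhdsWithin).exists
  obtain ⟨P⟩ := nonempty_smallPieces hK hs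
  refine ⟨P.averaging, P.isCompactOperator_averaging, fun p => ?_⟩
  have hle := P.norm_sub_averaging_sq_le hα hs (by positivity) hV (fun x hx => hKM hx) p
  refine le_of_sq_le_sq (hle.trans ?_) (by positivity)
  rw [mul_pow, inv_div]
  gcongr
  linarith

end Compactness

section Sobolev

variable {n : ℕ} {α : ℝ}

theorem two_lt_critExp (hα : 0 < α) (hn : 2 * α < n) : 2 < critExp n α := by
  have : (0 : ℝ) < n - 2 * α := by linarith
  rw [critExp, lt_div_iff₀ this]
  linarith

theorem growthExp_add_one (hn : 2 * α < n) : growthExp n α + 1 = critExp n α := by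
  have : (0 : ℝ) < n - 2 * α := by linarith
  rw [critExp, growthExp]
  field_simp
  ring

theorem growthExp_pos (hα : 0 < α) (hn : 2 * α < n) : 0 < growthExp n α := by
  linarith [growthExp_add_one hn, two_lt_critExp hα hn]

theorem natCast_mul_two_div_critExp (hα : 0 < α) (hn : 2 * α < n) :
    n * (2 / critExp n α) = n - 2 * α := by
  have hn0 : (0 : ℝ) < n := by linarith
  rw [critExp]
  field_simp

theorem one_add_div_eq_critExp_div_two (hn : 2 * α < n) :
    1 + 2 * α / (n - 2 * α) = critExp n α / 2 := by
  have : (0 : ℝ) < n - 2 * α := by linarith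
  rw [critExp]
  field_simp
  ring

theorem two_div_critExp_mul (hα : 0 < α) (hn : 2 * α < n) :
    2 / critExp n α * (2 * α / (n - 2 * α)) = 1 - 2 / critExp n α := by
  have : (0 : ℝ) < n - 2 * α := by linarith
  have hn0 : (0 : ℝ) < n := by linarith
  rw [critExp]
  field_simp
  ring

theorem rpow_le_of_forall_le_add {A X Y θ m : ℝ} (hA : 0 ≤ A) (hX : 0 ≤ X) (hY : 0 < Y)
    (hθ : 0 ≤ θ) (hm : 0 < m) (h : ∀ s : ℝ, 0 < s → A ≤ X * s ^ θ + Y * s ^ (-m)) :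
    A ^ (1 + θ / m) ≤ 2 * X * (2 * Y) ^ (θ / m) := by
  rcases hA.eq_or_lt with rfl | hA
  · rw [Real.zero_rpow (by positivity)]
    positivity
  -- At this radius the second term of `h` is half of the left-hand side.
  have hradius := h ((2 * Y / A) ^ (1 / m)) (by positivity)
  rw [← Real.rpow_mul (by positivity), ← Real.rpow_mul (by positivity),
    show 1 / m * -m = -1 by field_simp, Real.rpow_neg_one, one_div_mul_eq_div,
    Real.div_rpow (by positivity) hA.le] at hradius
  have hhalf : Y * (2 * Y / A)⁻¹ = A / 2 := by field_simp
  have hle : A / 2 ≤ X * (2 * Y) ^ (θ / m) / A ^ (θ / m) := by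
    rw [mul_div_assoc]
    linarith
  rw [le_div_iff₀ (by positivity)] at hle
  rw [Real.rpow_add hA, Real.rpow_one]
  linarith

theorem rpow_le_of_le_mul_rpow {T A θ : ℝ} (hT : 0 ≤ T) (hA : 0 ≤ A) (hθ : 0 < θ)
    (h : T ≤ A * T ^ (1 - θ)) : T ^ θ ≤ A := by
  rcases hT.eq_or_lt with rfl | hT
  · rwa [Real.zero_rpow hθ.ne']
  · rwa [Real.rpow_sub hT, Real.rpow_one, mul_div_assoc', le_div_iff₀ (by positivity), mul_comm A,
      mul_le_mul_iff_right₀ hT] at h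

theorem integrable_abs_rpow {X : Type*} [MeasurableSpace X] {ν : Measure X} {p : ℝ} (hp : 0 < p)
    {u : X → ℝ} (hu : MemLp u (ENNReal.ofReal p) ν) : Integrable (fun x => |u x| ^ p) ν := by
  have := hu.integrable_norm_rpow (by simpa using hp) ENNReal.ofReal_ne_top
  simpa only [ENNReal.toReal_ofReal hp.le, Real.norm_eq_abs] using this

theorem abs_setAverage_rpow_le {X : Type*} [MeasurableSpace X] {ν : Measure X} {p : ℝ} (hp : 1 ≤ p)
    {u : X → ℝ} (hu : MemLp u (ENNReal.ofReal p) ν) {B : Set X} (hB0 : ν B ≠ 0) (hB : ν B ≠ ∞) :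
    |⨍ x in B, u x ∂ν| ^ p ≤ (ν.real B)⁻¹ * ∫ x, |u x| ^ p ∂ν := by
  have hup := integrable_abs_rpow (by positivity) hu
  have : IsFiniteMeasure (ν.restrict B) := ⟨by simpa using hB.lt_top⟩
  have hint : Integrable u (ν.restrict B) :=
    (hu.restrict B).integrable (ENNReal.one_le_ofReal.2 hp)
  have habs : |⨍ x in B, u x ∂ν| ≤ ⨍ x in B, |u x| ∂ν := by
    rw [setAverage_eq, setAverage_eq, smul_eq_mul, smul_eq_mul, abs_mul,
      abs_of_nonneg (inv_nonneg.2 measureReal_nonneg)]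
    gcongr
    exact abs_integral_le_integral_abs
  calc |⨍ x in B, u x ∂ν| ^ p ≤ (⨍ x in B, |u x| ∂ν) ^ p := by gcongr
    _ ≤ ⨍ x in B, |u x| ^ p ∂ν := (convexOn_rpow hp).map_set_average_le
        (Real.continuous_rpow_const (by positivity)).continuousOn isClosed_Ici hB0 hB
        (Eventually.of_forall fun x => abs_nonneg (u x)) hint.abs hup.integrableOn
    _ ≤ (ν.real B)⁻¹ * ∫ x, |u x| ^ p ∂ν := by
        rw [setAverage_eq, smul_eq_mul]
        gcongr
        · exact Eventually.of_forall fun x => by positivity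
        · exact Measure.restrict_le_self

theorem sq_average_ball_le (hα : 0 < α) (hn : 2 * α < n) {u : E n → ℝ}
    (hu : MemLp u (ENNReal.ofReal (critExp n α)) volume) (x : E n) {s : ℝ} (hs : 0 < s) :
    (⨍ y in Metric.ball x s, u y) ^ 2 ≤
      ((volume.real (Metric.ball (0 : E n) 1))⁻¹ * ∫ y, |u y| ^ critExp n α) ^ (2 / critExp n α) *
        s ^ (-((n : ℝ) - 2 * α)) := by
  have hp := two_lt_critExp hα hn
  have hmean := abs_setAverage_rpow_le (by linarith) hu (Metric.measure_ball_pos _ x hs).ne'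
    measure_ball_lt_top.ne
  have hpow := Real.rpow_le_rpow (by positivity) hmean
    (show 0 ≤ 2 / critExp n α by positivity)
  have hT : 0 ≤ ∫ y, |u y| ^ critExp n α := integral_nonneg fun _ => by positivity
  rw [← Real.rpow_mul (abs_nonneg _), mul_div_cancel₀ _ (by linarith), Real.rpow_two, sq_abs,
    volume_real_ball x hs, mul_inv, mul_assoc, Real.mul_rpow (by positivity) (by positivity),
    mul_comm, Real.inv_rpow (by positivity), ← Real.rpow_mul hs.le,
    natCast_mul_two_div_critExp hα hn, ← Real.rpow_neg hs.le] at hpow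
  exact hpow

theorem exists_abs_rpow_critExp_le (n : ℕ) {α : ℝ} (hα : 0 < α) (hn : 2 * α < n) :
    ∃ S ≥ 0, ∀ u : E n → ℝ, MemLp u 2 volume → MemLp u (ENNReal.ofReal (critExp n α)) volume →
      0 < ∫ y, |u y| ^ critExp n α →
      ∀ x, Integrable (fun y => diffQuotient α u (x, y) ^ 2) volume → |u x| ^ critExp n α ≤
        S * density α u x * (∫ y, |u y| ^ critExp n α) ^ (1 - 2 / critExp n α) := by
  set b := volume.real (Metric.ball (0 : E n) 1)
  have hb : 0 < b := ENNReal.toReal_pos (Metric.measure_ball_pos _ _ one_pos).ne'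
    measure_ball_lt_top.ne
  have hκ := poincareConst_nonneg (n := n) (α := α) one_pos
  refine ⟨4 * poincareConst n α 1 * (4 ^ (2 * α / (n - 2 * α)) * b⁻¹ ^ (1 - 2 / critExp n α)),
    by positivity, fun u hu hup hT x hx => ?_⟩
  set p := critExp n α
  set T := ∫ y, |u y| ^ p
  have hD := density_nonneg (α := α) u x
  have hradius : ∀ s : ℝ, 0 < s → u x ^ 2 ≤ 2 * (poincareConst n α 1 * density α u x) * s ^ (2 * α)
      + 2 * ((b⁻¹ * T) ^ (2 / p)) * s ^ (-((n : ℝ) - 2 * α)) := fun s hs => by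
    have hosc := sq_sub_average_le hα hu hs (Metric.mem_ball_self hs) hx
    have hmean := sq_average_ball_le hα hn hup x hs
    rw [poincareConst_eq hs] at hosc
    linarith [add_sq_le (a := u x - ⨍ y in Metric.ball x s, u y)
      (b := ⨍ y in Metric.ball x s, u y), sub_add_cancel (u x) (⨍ y in Metric.ball x s, u y)]
  have hopt := rpow_le_of_forall_le_add (sq_nonneg _) (by positivity) (by positivity)
    (by positivity) (by linarith) hradius
  rw [one_add_div_eq_critExp_div_two hn, ← sq_abs, ← Real.rpow_two,
    ← Real.rpow_mul (abs_nonneg _), mul_div_cancel₀ _ two_ne_zero, ← mul_assoc 2 2 ((_ : ℝ) ^ _),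
    Real.mul_rpow (by positivity) (by positivity), ← Real.rpow_mul (by positivity),
    two_div_critExp_mul hα hn, Real.mul_rpow (by positivity) hT.le] at hopt
  refine hopt.trans_eq ?_
  norm_num
  ring

theorem exists_sobolev_of_memLp (n : ℕ) {α : ℝ} (hα : 0 < α) (hn : 2 * α < n) :
    ∃ S ≥ 0, ∀ u : E n → ℝ, MemH α u → MemLp u (ENNReal.ofReal (critExp n α)) volume →
      eLpNorm u (ENNReal.ofReal (critExp n α)) volume ≤
        ENNReal.ofReal (S * √(∫ z, diffQuotient α u z ^ 2 ∂(volume.prod volume))) := by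
  obtain ⟨S, hS, hpointwise⟩ := exists_abs_rpow_critExp_le n hα hn
  refine ⟨√S, by positivity, fun u hu hup => ?_⟩
  have hp := two_lt_critExp hα hn
  set p := critExp n α
  have hp0 : 0 < p := by linarith
  set G := ∫ z, diffQuotient α u z ^ 2 ∂((volume : Measure (E n)).prod volume)
  have : 0 ≤ G := integral_nonneg fun _ => sq_nonneg _
  set T := ∫ y, |u y| ^ p
  have hT : 0 ≤ T := integral_nonneg fun _ => by positivity
  have hquot := integrable_sq_diffQuotient hu
  have hself : T ≤ S * G * T ^ (1 - 2 / p) := by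
    rcases hT.eq_or_lt with hT0 | hT0
    · rw [← hT0]
      positivity
    calc T ≤ ∫ x, S * density α u x * T ^ (1 - 2 / p) :=
          integral_mono_ae (integrable_abs_rpow hp0 hup)
            ((hquot.integral_prod_left.const_mul S).mul_const _) (by
              filter_upwards [hquot.prod_right_ae] with x hx
              exact hpointwise u hu.1 hup hT0 x hx)
      _ = S * G * T ^ (1 - 2 / p) := by
          rw [integral_mul_const, integral_const_mul, integral_density hu]
  have hle : T ^ (2 / p) ≤ S * G := rpow_le_of_le_mul_rpow hT (by positivity) (by positivity) hself
  rw [hup.eLpNorm_eq_integral_rpow_norm (by simpa using hp0) ENNReal.ofReal_ne_top,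
    ENNReal.toReal_ofReal hp0.le]
  simp_rw [Real.norm_eq_abs]
  refine ENNReal.ofReal_le_ofReal ?_
  rw [← Real.sqrt_mul hS]
  refine Real.le_sqrt_of_sq_le ?_
  rwa [← Real.rpow_mul_natCast hT, Nat.cast_two, inv_mul_eq_div]

/-- Truncation of a real number at height `M`. -/
def clamp (M t : ℝ) : ℝ := max (-M) (min t M)

theorem continuous_clamp (M : ℝ) : Continuous (clamp M) := by
  unfold clamp
  fun_prop

theorem abs_clamp_le {M : ℝ} (hM : 0 ≤ M) (t : ℝ) : |clamp M t| ≤ M :=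
  abs_le.2 ⟨le_max_left _ _, max_le (by linarith) (min_le_right _ _)⟩

theorem clamp_of_abs_le {M t : ℝ} (h : |t| ≤ M) : clamp M t = t := by
  rw [clamp, min_eq_left (le_of_abs_le h), max_eq_right (neg_le_of_abs_le h)]

theorem abs_clamp_sub_clamp_le (M t s : ℝ) : |clamp M t - clamp M s| ≤ |t - s| := by
  refine (abs_max_sub_max_le_max _ _ _ _).trans (max_le (by simp) ?_)
  refine (abs_min_sub_min_le_max _ _ _ _).trans (max_le le_rfl (by simp))

theorem abs_clamp_le_abs {M : ℝ} (hM : 0 ≤ M) (t : ℝ) : |clamp M t| ≤ |t| := by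
  simpa [clamp_of_abs_le (t := 0) (by simpa using hM)] using abs_clamp_sub_clamp_le M t 0

theorem sq_diffQuotient_le {u w : E n → ℝ} {x y : E n} (h : |w x - w y| ≤ |u x - u y|) :
    diffQuotient α w (x, y) ^ 2 ≤ diffQuotient α u (x, y) ^ 2 := by
  rw [diffQuotient_sq, diffQuotient_sq]
  gcongr ?_ / _
  exact sq_le_sq.2 h

theorem memLp_ofReal_of_abs_le {X : Type*} [MeasurableSpace X] {ν : Measure X} {p M : ℝ}
    (hp : 2 ≤ p) {u : X → ℝ} (hu : MemLp u 2 ν) (hM : ∀ x, |u x| ≤ M) :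
    MemLp u (ENNReal.ofReal p) ν := by
  rw [← integrable_norm_rpow_iff hu.aestronglyMeasurable (ENNReal.ofReal_pos.2 (by linarith)).ne'
    ENNReal.ofReal_ne_top, ENNReal.toReal_ofReal (by linarith)]
  refine (hu.integrable_sq.const_mul (M ^ (p - 2))).mono'
    (hu.aestronglyMeasurable.norm.aemeasurable.pow_const p).aestronglyMeasurable
    (Eventually.of_forall fun x => ?_)
  rw [Real.norm_of_nonneg (by positivity), Real.norm_eq_abs, ← sq_abs (u x),
    ← sub_add_cancel p 2, Real.rpow_add_of_nonneg (abs_nonneg _) (by linarith) two_pos.le,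
    Real.rpow_two, sub_add_cancel]
  gcongr
  exact hM x

theorem exists_sobolev (n : ℕ) {α : ℝ} (hα : 0 < α) (hn : 2 * α < n) :
    ∃ S ≥ 0, ∀ u : E n → ℝ, MemH α u → eLpNorm u (ENNReal.ofReal (critExp n α)) volume ≤
      ENNReal.ofReal (S * √(∫ z, diffQuotient α u z ^ 2 ∂(volume.prod volume))) := by
  obtain ⟨S, hS, hsobolev⟩ := exists_sobolev_of_memLp n hα hn
  refine ⟨S, hS, fun u hu => ?_⟩
  have hmeas (M : ℕ) : AEStronglyMeasurable (fun x => clamp M (u x)) volume :=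
    (continuous_clamp M).comp_aestronglyMeasurable hu.1.aestronglyMeasurable
  have hquot := integrable_sq_diffQuotient hu
  refine Lp.eLpNorm_le_of_ae_tendsto (u := atTop) (f := fun (M : ℕ) x => clamp M (u x))
    (Eventually.of_forall fun M => ?_) hmeas (Eventually.of_forall fun x => ?_)
  · have hL2 : MemLp (fun x => clamp M (u x)) 2 volume :=
      hu.1.mono (hmeas M) (Eventually.of_forall fun x => abs_clamp_le_abs M.cast_nonneg _)
    have hle : ∀ z : E n × E n,
        diffQuotient α (fun x => clamp M (u x)) z ^ 2 ≤ diffQuotient α u z ^ 2 :=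
      fun z => sq_diffQuotient_le (abs_clamp_sub_clamp_le _ _ _)
    have hint : Integrable (fun z => diffQuotient α (fun x => clamp M (u x)) z ^ 2)
        (volume.prod volume) :=
      hquot.mono' ((aestronglyMeasurable_diffQuotient (hmeas M)).pow 2)
        (Eventually.of_forall fun z => (Real.norm_of_nonneg (sq_nonneg _)).trans_le (hle z))
    refine (hsobolev _ ⟨hL2, by simpa only [diffQuotient_sq] using hint⟩ (memLp_ofReal_of_abs_le
      (two_lt_critExp hα hn).le hL2 fun x => abs_clamp_le M.cast_nonneg _)).trans ?_
    gcongr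
    exact hle
  · refine tendsto_const_nhds.congr' ?_
    filter_upwards [eventually_ge_atTop ⌈|u x|⌉₊] with M hM
    exact (clamp_of_abs_le (Nat.ceil_le.1 hM)).symm

end Sobolev

section SobolevConst

variable {n : ℕ} {α : ℝ} {V : E n → ℝ}

theorem sqrt_integral_sq_diffQuotient_le (hV : UniformlyPositive V) (p : energySpace α hV) :
    √(∫ z, diffQuotient α (toL2 α hV p) z ^ 2 ∂(volume.prod volume)) ≤ ‖p‖ := by
  have hpot : 0 ≤ ∫ x, V x * toL2 α hV p x ^ 2 :=
    integral_nonneg fun x => mul_nonneg (hV.pos x).le (sq_nonneg _)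
  exact Real.sqrt_le_iff.2 ⟨norm_nonneg p, (norm_sq_eq p).symm ▸ le_add_of_nonneg_right hpot⟩

theorem exists_isSobolevEmbedding_toL2 (hα : 0 < α) (hn : 2 * α < n) (hV : UniformlyPositive V) :
    ∃ C, IsSobolevEmbedding (toL2 α hV) (growthExp n α) C := by
  obtain ⟨S, hS, hsobolev⟩ := exists_sobolev n hα hn
  refine ⟨max S ‖toL2 α hV‖, hS.trans (le_max_left _ _), fun p => ?_, fun p => ?_⟩
  · exact (toL2 α hV).le_of_opNorm_le (le_max_right _ _) p
  · rw [growthExp_add_one hn]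
    refine (hsobolev _ (memHV_toL2 p).1).trans (ENNReal.ofReal_le_ofReal ?_)
    exact mul_le_mul (le_max_left _ _) (sqrt_integral_sq_diffQuotient_le hV p) (Real.sqrt_nonneg _)
      (hS.trans (le_max_left _ _))

theorem isSobolevEmbedding_toL2_iff (hn : 2 * α < n) (hV : UniformlyPositive V) {C : ℝ} :
    IsSobolevEmbedding (toL2 α hV) (growthExp n α) C ↔ 0 ≤ C ∧ ∀ u : E n → ℝ, MemHV α V u →
      eLpNorm u 2 volume ≤ ENNReal.ofReal (C * normV α V u) ∧
      eLpNorm u (ENNReal.ofReal (critExp n α)) volume ≤ ENNReal.ofReal (C * normV α V u) := by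
  refine ⟨fun h => ⟨h.nonneg, fun u hu => ?_⟩, fun ⟨hC, h⟩ => ⟨hC, fun p => ?_, fun p => ?_⟩⟩
  · obtain ⟨p, hp⟩ := exists_toL2_ae_eq hV hu
    rw [← normV_congr hp, normV_toL2, ← eLpNorm_congr_ae hp, ← eLpNorm_congr_ae hp,
      ← growthExp_add_one hn, ← ENNReal.ofReal_toReal (Lp.memLp (toL2 α hV p)).eLpNorm_ne_top,
      ← Lp.norm_def]
    exact ⟨ENNReal.ofReal_le_ofReal (h.norm_le p), h.eLpNorm_le p⟩
  · rw [Lp.norm_def, ← normV_toL2]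
    exact ENNReal.toReal_le_of_le_ofReal (mul_nonneg hC (Real.sqrt_nonneg _))
      (h _ (memHV_toL2 p)).1
  · rw [growthExp_add_one hn, ← normV_toL2]
    exact (h _ (memHV_toL2 p)).2

theorem isSobolevEmbedding_toL2 (hα : 0 < α) (hn : 2 * α < n) (hV : UniformlyPositive V) :
    IsSobolevEmbedding (toL2 α hV) (growthExp n α) (sobolevConst α V) := by
  have hmem := (isClosed_setOf_isSobolevEmbedding (toL2 α hV) (growthExp n α)).csInf_mem
    (exists_isSobolevEmbedding_toL2 hα hn hV) ⟨0, fun _ hC => hC.nonneg⟩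
  simp only [isSobolevEmbedding_toL2_iff hn hV] at hmem
  exact (isSobolevEmbedding_toL2_iff hn hV).2 hmem

theorem integrable_min_kernel (hn : n ≠ 0) (hα0 : 0 < α) (hα1 : α < 1) :
    Integrable (fun x : E n => min 1 (‖x‖ ^ 2) / ‖x‖ ^ ((n : ℝ) + 2 * α)) volume := by
  have : Nonempty (Fin n) := ⟨⟨0, Nat.pos_of_ne_zero hn⟩⟩
  refine (integrable_fun_norm_addHaar (volume : Measure (E n))
    (f := fun s : ℝ => min 1 (s ^ 2) / s ^ ((n : ℝ) + 2 * α))).2 ?_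
  rw [finrank_euclideanSpace, Fintype.card_fin]
  have hpow : ∀ s : ℝ, s ^ (n - 1) = s ^ ((n : ℝ) - 1) := fun s => by
    rw [← Real.rpow_natCast, Nat.cast_sub (Nat.pos_of_ne_zero hn), Nat.cast_one]
  rw [← Set.Ioo_union_Ici_eq_Ioi one_pos, integrableOn_union]
  constructor
  · refine ((intervalIntegral.integrableOn_Ioo_rpow_iff one_pos).2
      (by linarith : -1 < 1 - 2 * α)).congr_fun (fun s ⟨hs0, hs1⟩ => ?_) measurableSet_Ioo
    simp only [smul_eq_mul]
    rw [min_eq_right (pow_le_one₀ hs0.le hs1.le), hpow, ← Real.rpow_natCast s 2,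
      ← Real.rpow_sub hs0, ← Real.rpow_add hs0]
    congr 1
    push_cast
    ring
  · rw [integrableOn_Ici_iff_integrableOn_Ioi]
    refine (integrableOn_Ioi_rpow_of_lt (by linarith : -1 - 2 * α < -1) one_pos).congr_fun
      (fun s (hs : 1 < s) => ?_) measurableSet_Ioi
    have hs0 : 0 < s := one_pos.trans hs
    simp only [smul_eq_mul]
    rw [min_eq_left (one_le_pow₀ hs.le), hpow, one_div, ← Real.rpow_neg hs0.le, ← Real.rpow_add hs0]
    congr 1
    ring

theorem integrable_indicator_add_mul_comp_sub {K : Set (E n)} (hK : IsCompact K) {k : E n → ℝ}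
    (hk : Integrable k volume) (hsymm : ∀ x, k (-x) = k x) :
    Integrable (fun z : E n × E n => (K.indicator 1 z.1 + K.indicator 1 z.2) * k (z.1 - z.2))
      (volume.prod volume) := by
  have hK1 : Integrable (K.indicator (1 : E n → ℝ)) volume :=
    (integrable_indicator_iff hK.measurableSet).2 (integrableOn_const hK.measure_lt_top.ne)
  have hsnd := hK1.convolution_integrand (ContinuousLinearMap.mul ℝ ℝ) hk
  refine (hsnd.swap.add hsnd).congr (Eventually.of_forall fun z => ?_)
  simp only [Pi.add_apply, Function.comp_apply, Prod.fst_swap, Prod.snd_swap,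
    ContinuousLinearMap.mul_apply', add_mul, ← neg_sub z.1 z.2, hsymm]

theorem exists_sq_sub_le_of_lipschitzWith {L : NNReal} {u : E n → ℝ} (hu : LipschitzWith L u)
    (hsupp : HasCompactSupport u) : ∃ c, ∀ x y, (u x - u y) ^ 2 ≤ c * ((tsupport u).indicator 1 x +
      (tsupport u).indicator 1 y) * min 1 (‖x - y‖ ^ 2) := by
  obtain ⟨M, hM⟩ := hu.continuous.bounded_above_of_compact_support hsupp
  have hmin (x y) : (u x - u y) ^ 2 ≤ max (2 * M) L ^ 2 * min 1 (‖x - y‖ ^ 2) := by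
    have hdiff : ‖u x - u y‖ ≤ 2 * M :=
      (norm_sub_le _ _).trans (by linarith [hM x, hM y])
    rw [mul_min_of_nonneg _ _ (sq_nonneg _), mul_one, ← mul_pow, ← sq_abs (u x - u y),
      ← Real.norm_eq_abs]
    refine le_min ?_ ?_ <;> gcongr
    · exact hdiff.trans (le_max_left _ _)
    · refine (hu.norm_sub_le x y).trans ?_
      gcongr
      exact le_max_right _ _
  refine ⟨max (2 * M) L ^ 2, fun x y => ?_⟩
  by_cases hxy : x ∈ tsupport u ∨ y ∈ tsupport u
  · have hone : (1 : ℝ) ≤ (tsupport u).indicator 1 x + (tsupport u).indicator 1 y := by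
      have hnonneg := Set.indicator_nonneg (s := tsupport u) (f := (1 : E n → ℝ))
        fun _ _ => zero_le_one
      rcases hxy with h | h <;> simp [Set.indicator_of_mem h, hnonneg]
    refine (hmin x y).trans ?_
    gcongr
    exact le_mul_of_one_le_right (by positivity) hone
  · rw [not_or] at hxy
    simp [image_eq_zero_of_notMem_tsupport, hxy]

theorem memH_of_lipschitzWith (hn : n ≠ 0) (hα0 : 0 < α) (hα1 : α < 1) {L : NNReal} {u : E n → ℝ}
    (hu : LipschitzWith L u) (hsupp : HasCompactSupport u) : MemH α u := by
  obtain ⟨c, hc⟩ := exists_sq_sub_le_of_lipschitzWith hu hsupp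
  refine ⟨hu.continuous.memLp_of_hasCompactSupport hsupp, ?_⟩
  simp only [← diffQuotient_sq]
  refine ((integrable_indicator_add_mul_comp_sub hsupp (integrable_min_kernel hn hα0 hα1)
    fun x => by rw [norm_neg]).const_mul c).mono'
    ((aestronglyMeasurable_diffQuotient hu.continuous.aestronglyMeasurable).pow 2)
    (Eventually.of_forall fun z => ?_)
  rw [Real.norm_of_nonneg (sq_nonneg _), diffQuotient_sq, ← mul_assoc, mul_div_assoc']
  gcongr
  exact hc _ _

theorem exists_toL2_ne_zero (hn : n ≠ 0) (hα0 : 0 < α) (hα1 : α < 1) (hV : UniformlyPositive V) :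
    ∃ p, toL2 α hV p ≠ 0 := by
  let φ : ContDiffBump (0 : E n) := default
  obtain ⟨L, hL⟩ := (φ.contDiff (n := 1)).lipschitzWith_of_hasCompactSupport φ.hasCompactSupport
    one_ne_zero
  have hpot : Integrable (fun x => V x * φ x ^ 2) volume :=
    (hV.continuous.mul (φ.continuous.pow 2)).integrable_of_hasCompactSupport
      ((φ.hasCompactSupport.comp_left (g := (· ^ 2)) (zero_pow two_ne_zero)).mul_left)
  obtain ⟨p, hp⟩ := exists_toL2_ae_eq hV
    (u := φ) ⟨memH_of_lipschitzWith hn hα0 hα1 hL φ.hasCompactSupport, hpot⟩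
  refine ⟨p, fun h0 => (φ.integral_pos (μ := volume)).ne' (integral_eq_zero_of_ae ?_)⟩
  rw [h0] at hp
  exact hp.symm.trans (Lp.coeFn_zero _ _ _)

theorem ne_zero_of_two_mul_lt (hα : 0 < α) (hn : 2 * α < n) : n ≠ 0 := by
  rintro rfl
  rw [Nat.cast_zero] at hn
  linarith

theorem sobolevConst_pos (hα0 : 0 < α) (hα1 : α < 1) (hn : 2 * α < n) (hV : UniformlyPositive V) :
    0 < sobolevConst α V := by
  obtain ⟨p, hp⟩ := exists_toL2_ne_zero (ne_zero_of_two_mul_lt hα0 hn) hα0 hα1 hV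
  have hle := (isSobolevEmbedding_toL2 hα0 hn hV).norm_le p
  exact pos_of_mul_pos_left ((norm_pos_iff.2 hp).trans_le hle) (norm_nonneg p)

end SobolevConst

section Transfer

variable {n : ℕ} {α : ℝ} {V : E n → ℝ} {f : ℝ → ℝ} {h : E n → ℝ} {r : ℝ}

theorem energy_congr {u w : E n → ℝ} (huw : u =ᵐ[volume] w) :
    energy α V f h u = energy α V f h w := by
  have hprim : ∫ x, primitive f (u x) = ∫ x, primitive f (w x) :=
    integral_congr_ae (huw.fun_comp (primitive f))
  have hsource : ∫ x, h x * u x = ∫ x, h x * w x :=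
    integral_congr_ae (EventuallyEq.rfl.mul huw)
  rw [energy, energy, normV_congr huw, hprim, hsource]

variable {hV : UniformlyPositive V}

/-- The Riesz representative in the energy space of the functional `u ↦ ∫ h u`. -/
noncomputable def sourceVector (α : ℝ) (hV : UniformlyPositive V) (hh : MemLp h 2 volume) :
    energySpace α hV :=
  (toL2 α hV).adjoint (hh.toLp h)

theorem inner_sourceVector (hh : MemLp h 2 volume) (p : energySpace α hV) :
    inner ℝ (sourceVector α hV hh) p = ∫ x, h x * toL2 α hV p x := by
  rw [sourceVector, ContinuousLinearMap.adjoint_inner_left, L2.inner_def]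
  refine integral_congr_ae ?_
  filter_upwards [hh.coeFn_toLp] with x hx
  rw [hx, RCLike.inner_apply, conj_trivial, mul_comm]

theorem norm_sourceVector_le (hα : 0 < α) (hn : 2 * α < n) (hh : MemLp h 2 volume) :
    ‖sourceVector α hV hh‖ ≤ sobolevConst α V * (eLpNorm h 2 volume).toReal := by
  have hJ := isSobolevEmbedding_toL2 hα hn hV
  rw [← Lp.norm_toLp h hh]
  refine (toL2 α hV).adjoint.le_of_opNorm_le ?_ _
  rw [LinearIsometryEquiv.norm_map]
  exact (toL2 α hV).opNorm_le_bound hJ.nonneg hJ.norm_le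

theorem norm_sourceVector_lt (hα0 : 0 < α) (hα1 : α < 1) (hn : 2 * α < n) (hh : MemLp h 2 volume)
    {t : ℝ} (ht : (eLpNorm h 2 volume).toReal < r / sobolevConst α V * t) :
    ‖sourceVector α hV hh‖ < r * t := by
  have hC := sobolevConst_pos hα0 hα1 hn hV
  calc ‖sourceVector α hV hh‖ ≤ sobolevConst α V * (eLpNorm h 2 volume).toReal :=
        norm_sourceVector_le hα0 hn hh
    _ < sobolevConst α V * (r / sobolevConst α V * t) := by gcongr
    _ = r * t := by field_simp

theorem energy_toL2 (hh : MemLp h 2 volume) (p : energySpace α hV) :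
    energy α V f h (toL2 α hV p) = semilinearEnergy f (toL2 α hV) (sourceVector α hV hh) p := by
  rw [energy, semilinearEnergy, normV_toL2, inner_sourceVector, potential]

theorem isWeakSolution_toL2 (hα : 0 < α) (hn : 2 * α < n) (hf : IsSubcritical f (growthExp n α))
    (hh : MemLp h 2 volume) {p : energySpace α hV}
    (hp : ∇ (semilinearEnergy f (toL2 α hV) (sourceVector α hV hh)) p = 0) :
    IsWeakSolution α V f h (toL2 α hV p) := by
  have hJ := isSobolevEmbedding_toL2 hα hn hV
  have hq := growthExp_pos hα hn
  have heq : p = ∇ (potential f (toL2 α hV)) p + sourceVector α hV hh := by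
    rwa [hJ.gradient_semilinearEnergy hf hq, sub_sub, sub_eq_zero] at hp
  refine ⟨memHV_toL2 p, fun w hw => ?_⟩
  obtain ⟨φ, hφ⟩ := exists_toL2_ae_eq hV hw
  have hfφ := hJ.integrable_nemytskii_mul hf hq p φ
  have hhφ : Integrable (fun x => h x * toL2 α hV φ x) volume :=
    hh.integrable_mul (Lp.memLp (toL2 α hV φ))
  have hae : (fun x => f (toL2 α hV p x) * toL2 α hV φ x + h x * toL2 α hV φ x) =ᵐ[volume]
      fun x => (f (toL2 α hV p x) + h x) * w x := by
    filter_upwards [hφ] with x hx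
    rw [hx, add_mul]
  refine ⟨(hfφ.add hhφ).congr hae, ?_⟩
  calc innerV α V (toL2 α hV p) w = inner ℝ p φ :=
        (innerV_congr EventuallyEq.rfl hφ.symm).trans (inner_eq_innerV p φ).symm
    _ = inner ℝ (∇ (potential f (toL2 α hV)) p + sourceVector α hV hh) φ := by rw [← heq]
    _ = (∫ x, f (toL2 α hV p x) * toL2 α hV φ x) + ∫ x, h x * toL2 α hV φ x := by
        rw [inner_add_left, hJ.inner_gradient_potential hf hq, inner_sourceVector]
    _ = ∫ x, (f (toL2 α hV p x) + h x) * w x :=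
        (integral_add hfφ hhφ).symm.trans (integral_congr_ae hae)

theorem isCriticalPt_toL2 (hh : MemLp h 2 volume) {p : energySpace α hV}
    (hp : HasGradientAt (semilinearEnergy f (toL2 α hV) (sourceVector α hV hh)) 0 p) :
    IsCriticalPt α V f h (toL2 α hV p) := by
  refine ⟨memHV_toL2 p, fun c hc => ?_⟩
  rw [hasGradientAt_iff_isLittleO, isLittleO_iff] at hp
  obtain ⟨s, hs, hball⟩ := Metric.eventually_nhds_iff.1 (hp hc)
  refine ⟨s, hs, fun w hw hws => ?_⟩
  obtain ⟨φ, hφ⟩ := exists_toL2_ae_eq hV hw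
  have hadd : toL2 α hV (p + φ) =ᵐ[volume] toL2 α hV p + w := by
    rw [map_add]
    exact (Lp.coeFn_add _ _).trans (EventuallyEq.rfl.add hφ)
  rw [← normV_congr hφ, normV_toL2] at hws ⊢
  have hle := hball (y := p + φ) (by rwa [dist_eq_norm, add_sub_cancel_left])
  rwa [add_sub_cancel_left, inner_zero_left, sub_zero, ← energy_toL2, ← energy_toL2,
    energy_congr hadd, Real.norm_eq_abs] at hle

theorem energy_toL2_le_of_forall_le (hh : MemLp h 2 volume) {p : energySpace α hV}
    (hmin : ∀ φ, ‖φ‖ ≤ r → semilinearEnergy f (toL2 α hV) (sourceVector α hV hh) p ≤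
      semilinearEnergy f (toL2 α hV) (sourceVector α hV hh) φ)
    {w : E n → ℝ} (hw : MemHV α V w) (hwr : normV α V w ≤ r) :
    energy α V f h (toL2 α hV p) ≤ energy α V f h w := by
  obtain ⟨φ, hφ⟩ := exists_toL2_ae_eq hV hw
  rw [← normV_congr hφ, normV_toL2] at hwr
  rw [← energy_congr hφ, energy_toL2 hh p, energy_toL2 hh φ]
  exact hmin φ hwr

theorem normV_sub_of_ae_eq {p q : energySpace α hV} {u w : E n → ℝ} (hu : toL2 α hV p =ᵐ[volume] u)
    (hw : toL2 α hV q =ᵐ[volume] w) : normV α V (u - w) = ‖p - q‖ := by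
  rw [← normV_toL2]
  exact normV_congr ((hu.symm.sub hw.symm).trans (coeFn_map_sub _ p q).symm)

theorem eq_zero_of_toL2_ae_eq_zero {p : energySpace α hV} (hp : toL2 α hV p =ᵐ[volume] 0) :
    p = 0 := by
  have hnorm := normV_sub_of_ae_eq hp (coeFn_map_zero (toL2 α hV))
  rwa [sub_self, sub_zero, ← normV_congr (coeFn_map_zero (toL2 α hV)), normV_toL2, norm_zero,
    eq_comm, norm_eq_zero] at hnorm

theorem isMountainPath_extend (hh : MemLp h 2 volume) {γ : C(unitInterval, energySpace α hV)}
    (hγ : γ ∈ admissiblePaths (semilinearEnergy f (toL2 α hV) (sourceVector α hV hh)) r) :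
    IsMountainPath α V f h r fun t => toL2 α hV (Set.IccExtend zero_le_one γ t) := by
  obtain ⟨hzero, hnorm, henergy⟩ := hγ
  have hleft : Set.IccExtend zero_le_one γ (0 : ℝ) = 0 := (Set.IccExtend_left _ _).trans hzero
  have hright : Set.IccExtend zero_le_one γ (1 : ℝ) = γ 1 := Set.IccExtend_right _ _
  refine ⟨fun t _ => memHV_toL2 _, fun t _ => ?_, ?_, ?_, ?_⟩
  · simp_rw [normV_sub_of_ae_eq (EventuallyEq.refl _ _) (EventuallyEq.refl _ _)]
    exact (tendsto_iff_norm_sub_tendsto_zero.1 (γ.continuous.Icc_extend'.tendsto t)).mono_left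
      nhdsWithin_le_nhds
  · simp only [hleft]
    exact coeFn_map_zero _
  · simpa only [hright, normV_toL2] using hnorm
  · simpa only [hright, energy_toL2 hh] using henergy

theorem exists_path_lift {γ : ℝ → E n → ℝ} (hγ : IsMountainPath α V f h r γ) :
    ∃ P : C(unitInterval, energySpace α hV),
      ∀ t : unitInterval, toL2 α hV (P t) =ᵐ[volume] γ t := by
  choose P hP using fun t : unitInterval => exists_toL2_ae_eq hV (hγ.1 t t.2)
  refine ⟨⟨P, continuous_iff_continuousAt.2 fun t => ?_⟩, hP⟩
  rw [ContinuousAt, tendsto_iff_norm_sub_tendsto_zero]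
  simp_rw [← normV_sub_of_ae_eq (hP _) (hP t)]
  exact (hγ.2.1 t t.2).comp (tendsto_nhdsWithin_iff.2
    ⟨continuous_subtype_val.tendsto t, Eventually.of_forall fun s => s.2⟩)

theorem isMountainPassLevel_of_isGLB (hh : MemLp h 2 volume) {c : ℝ}
    (hcont : Continuous (semilinearEnergy f (toL2 α hV) (sourceVector α hV hh)))
    (hc : IsGLB (pathMax (semilinearEnergy f (toL2 α hV) (sourceVector α hV hh)) ''
      admissiblePaths (semilinearEnergy f (toL2 α hV) (sourceVector α hV hh)) r) c) :
    IsMountainPassLevel α V f h r c := by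
  constructor
  · rintro m ⟨γ, hγ, hm⟩
    obtain ⟨P, hP⟩ := exists_path_lift (hV := hV) hγ
    have henergy (t : unitInterval) : energy α V f h (γ t) =
        semilinearEnergy f (toL2 α hV) (sourceVector α hV hh) (P t) := by
      rw [← energy_congr (hP t), energy_toL2 hh]
    rw [Set.image_eq_range] at hm
    simp_rw [henergy] at hm
    rw [hm.unique (isGreatest_pathMax hcont P)]
    refine hc.1 ⟨P, ⟨eq_zero_of_toL2_ae_eq_zero ((hP 0).trans hγ.2.2.1), ?_, ?_⟩, rfl⟩
    · rw [← normV_toL2, normV_congr (hP 1)]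
      exact hγ.2.2.2.1
    · rw [← henergy]
      exact hγ.2.2.2.2
  · rintro b hb
    refine hc.2 ?_
    rintro _ ⟨γ, hγ, rfl⟩
    refine hb ⟨_, isMountainPath_extend hh hγ, ?_⟩
    rw [Set.image_eq_range]
    simp_rw [Set.IccExtend_val, energy_toL2 hh]
    exact isGreatest_pathMax hcont γ

end Transfer

end FracSchrodinger

open FracSchrodinger in
theorem theorem1p1_general (n : ℕ) (α : ℝ) (hn : 2 * α < n) (hα0 : 0 < α) (hα1 : α < 1)
    (V : E n → ℝ) (hV : UniformlyPositive V) (hVinf : Tendsto V (cocompact (E n)) atTop)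
    (f : ℝ → ℝ) (hf : IsSubcritical f (growthExp n α))
    (μ : ℝ) (hμ : 2 < μ) (hAR : AmbrosettiRabinowitz f μ)
    (a b : ℝ) (ha : 0 ≤ a) (hb : 0 ≤ b) (hgrowth : ∀ t, |f t| ≤ a * |t| + b * |t| ^ growthExp n α)
    (r : ℝ) (hr : 0 < r) (h : E n → ℝ) (hh : MemLp h 2 volume)
    (hsmall : (eLpNorm h 2 volume).toReal < r / sobolevConst α V *
      (1 / 2 - a * sobolevConst α V ^ 2
        - b * sobolevConst α V ^ critExp n α * r ^ (critExp n α - 2))) :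
    ∃ u₁ u₂ : E n → ℝ, IsWeakSolution α V f h u₁ ∧ IsWeakSolution α V f h u₂ ∧
      ¬ u₁ =ᵐ[volume] u₂ ∧
      IsCriticalPt α V f h u₁ ∧ IsMountainPassLevel α V f h r (energy α V f h u₁) ∧
      0 < energy α V f h u₁ ∧
      IsCriticalPt α V f h u₂ ∧ normV α V u₂ < r ∧
      (∀ w : E n → ℝ, MemHV α V w → normV α V w ≤ r → energy α V f h u₂ ≤ energy α V f h w) ∧
      energy α V f h u₂ ≤ 0 := by
  have hJ := isSobolevEmbedding_toL2 hα0 hn hV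
  have hqp := growthExp_add_one hn
  have hq := growthExp_pos hα0 hn
  rw [show critExp n α - 2 = growthExp n α - 1 by linarith, ← hqp] at hsmall
  obtain ⟨p₀, hp₀⟩ := exists_toL2_ne_zero (ne_zero_of_two_mul_lt hα0 hn) hα0 hα1 hV
  obtain ⟨p₁, p₂, ⟨hgrad₁, hpos₁, hglb⟩, hgrad₂, hnorm₂, hmin⟩ :=
    hJ.exists_two_critical_points hf hq (isCompactOperator_toL2 hα0 hV hVinf) hμ hAR ha hb hgrowth
      hr (norm_sourceVector_lt hα0 hα1 hn hh hsmall) hp₀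
  have hgradient := hJ.hasGradientAt_semilinearEnergy (ξ := sourceVector α hV hh) hf hq
  simp_rw [← hJ.gradient_semilinearEnergy hf hq] at hgradient
  have hneg := hmin 0 (by simpa using hr.le)
  rw [semilinearEnergy_zero, ← energy_toL2] at hneg
  rw [← energy_toL2] at hpos₁ hglb
  exact ⟨toL2 α hV p₁, toL2 α hV p₂, isWeakSolution_toL2 hα0 hn hf hh hgrad₁,
    isWeakSolution_toL2 hα0 hn hf hh hgrad₂,
    fun h12 => (hneg.trans_lt hpos₁).ne' (energy_congr h12),
    isCriticalPt_toL2 hh (hgrad₁ ▸ hgradient p₁),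
    isMountainPassLevel_of_isGLB hh (hJ.contDiff_semilinearEnergy hf hq).continuous hglb, hpos₁,
    isCriticalPt_toL2 hh (hgrad₂ ▸ hgradient p₂), (normV_toL2 p₂).trans_lt hnorm₂,
    fun _ => energy_toL2_le_of_forall_le hh hmin, hneg⟩

theorem theorem1p1 (n : ℕ) (hn : 2 ≤ n) (α : ℝ) (hα0 : 0 < α) (hα1 : α < 1)
    (V : FracSchrodinger.E n → ℝ) (hVcont : Continuous V)
    (V₀ : ℝ) (hV₀ : 0 < V₀) (hV : ∀ x, V₀ ≤ V x)
    (hVinf : Tendsto V (cocompact (FracSchrodinger.E n)) atTop)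
    (f : ℝ → ℝ) (hfcont : Continuous f) (hf0 : f 0 = 0)
    (hfzero : f =o[𝓝 0] fun t => |t|)
    (hfinf : f =o[cocompact ℝ] fun t => |t| ^ FracSchrodinger.growthExp n α)
    (μ : ℝ) (hμ : 2 < μ)
    (hAR : ∀ t : ℝ, t ≠ 0 → 0 < μ * FracSchrodinger.primitive f t ∧
      μ * FracSchrodinger.primitive f t ≤ t * f t)
    (ε : ℝ) (hε : 0 < ε) (hεC : ε < 1 / (2 * FracSchrodinger.sobolevConst α V ^ 2))
    (δ ρ : ℝ) (hδ : 0 < δ) (hδρ : δ ≤ ρ)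
    (hfδ : ∀ t : ℝ, |t| ≤ δ → |f t| ≤ ε * |t|)
    (hfρ : ∀ t : ℝ, ρ ≤ |t| → |f t| ≤ ε * |t| ^ FracSchrodinger.growthExp n α)
    (r : ℝ) (hr : 0 < r)
    (h : FracSchrodinger.E n → ℝ) (hL2 : MemLp h 2 volume) (hne : ¬ h =ᵐ[volume] 0)
    (hsmall : (eLpNorm h 2 volume).toReal <
      r / FracSchrodinger.sobolevConst α V *
        (1 / 2 - ε * FracSchrodinger.sobolevConst α V ^ 2
          - (ε + FracSchrodinger.growthConst f (FracSchrodinger.growthExp n α) δ ρ)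
            * FracSchrodinger.sobolevConst α V ^ FracSchrodinger.critExp n α
            * r ^ (FracSchrodinger.critExp n α - 2))) :
    ∃ u₁ u₂ : FracSchrodinger.E n → ℝ,
      FracSchrodinger.IsWeakSolution α V f h u₁ ∧
      FracSchrodinger.IsWeakSolution α V f h u₂ ∧
      ¬ u₁ =ᵐ[volume] u₂ ∧
      FracSchrodinger.IsCriticalPt α V f h u₁ ∧
      FracSchrodinger.IsMountainPassLevel α V f h r (FracSchrodinger.energy α V f h u₁) ∧
      0 < FracSchrodinger.energy α V f h u₁ ∧
      FracSchrodinger.IsCriticalPt α V f h u₂ ∧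
      FracSchrodinger.normV α V u₂ < r ∧
      (∀ w : FracSchrodinger.E n → ℝ, FracSchrodinger.MemHV α V w →
        FracSchrodinger.normV α V w ≤ r →
        FracSchrodinger.energy α V f h u₂ ≤ FracSchrodinger.energy α V f h w) ∧
      FracSchrodinger.energy α V f h u₂ ≤ 0 := by
  have hαn : 2 * α < n := (mul_lt_of_lt_one_right two_pos hα1).trans_le (by exact_mod_cast hn)
  have hgrowth := FracSchrodinger.abs_le_of_growth hfcont
    (FracSchrodinger.growthExp_pos hα0 hαn).le hε.le hδ hfδ hfρ
  exact theorem1p1_general n α hαn hα0 hα1 V ⟨hVcont, V₀, hV₀, hV⟩ hVinf f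
    ⟨hfcont, hfzero, hfinf⟩ μ hμ hAR ε _ hε.le
    (add_nonneg hε.le (FracSchrodinger.growthConst_nonneg hδ.le)) hgrowth r hr h hL2 hsmall
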